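/- Let $M_1,\dots,M_4$ be generic complex $4\times4$ matrices (that is, $(M_1,\dots,M_4)$ lies in a suitable non-empty Zariski open subset of $(\mathbb C^{4\times 4})^4$), linearly independent, and let $W$ be their span, regarded as a space of bilinear forms $(x,y)\mapsto x^{T}My$ on $V=\mathbb C^4$. Write $M_i=A_i+B_i$ with $A_i$ symmetric and $B_i$ skew-symmetric. Let $X\subset \mathrm{Gr}(2,V)$ be the variety of two-dimensional subspaces $V_1\subset V$ such that the space of restrictions of the elements of $W$ to $V_1$ has dimension at most three. Let $Z\subset\mathbb P^3\times\mathbb P^3\times\mathbb P^1$ be the residual component of the intersection of the four $(1,1,1)$-divisors $x^{T}(sA_i+tB_i)y=0$, $i=1,\dots,4$, i.e. the Zariski closure of the complement of $\Delta=\{(x,x,(0:1)) : x\in\mathbb P^3\}$ in this intersection, and let $Z/\tau$ be its quotient by the involution $\tau:(x,y,(s:t))\mapsto(y,x,(s:-t))$. Then $Z/\tau$ is birational to $X$ via the map $(x,y,(s:t))\mapsto \mathbb Cx\oplus\mathbb Cy$. Precisely: for every point $(x,y,(s:t))\in Z$ with $x\neq y$ the subspace $\mathbb Cx\oplus\mathbb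 Cy$ belongs to $X$, and there are a dense open subset $U\subset Z/\tau$ and a dense open subset $U'\subset X$ such that $(x,y,(s:t))\mapsto \mathbb Cx\oplus\mathbb Cy$ induces an isomorphism $U\to U'$. -/

import Mathlib

open scoped LinearAlgebra.Projectivization Topology

noncomputable section

/-! ### Spaces with functions, morphisms, birational maps -/

/-- A topology on `P` together with, for each subset `U`, a specification of which complex valued
functions are regular on `U` (only the values on `U` matter, and only open `U` are used). -/
structure FunctionStructure (P : Type) where
  top : TopologicalSpace P
  IsRegularOn : Set P → (P → ℂ) → Prop

/-- The classical variety structure on a set `P` of points with homogeneous coordinates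
`c p : σ → ℂ`, where the coordinate `i` has (multi)degree `w i`.  The Zariski topology is generated
by the nonvanishing loci of (multi)homogeneous polynomials; a function is regular on `U` if locally
on `U` it is a quotient of two (multi)homogeneous polynomials of the same (multi)degree.
All conditions are insensitive to rescaling the homogeneous coordinates. -/
def homogeneousStructure {P σ D : Type} [AddCommMonoid D] (c : P → σ → ℂ) (w : σ → D) :
    FunctionStructure P where
  top := TopologicalSpace.generateFrom
    {U | ∃ (d : D) (F : MvPolynomial σ ℂ), F.IsWeightedHomogeneous w d ∧
      U = {p | MvPolynomial.eval (c p) F ≠ 0}}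
  IsRegularOn U f := ∀ p ∈ U, ∃ (d : D) (F G : MvPolynomial σ ℂ),
    F.IsWeightedHomogeneous w d ∧ G.IsWeightedHomogeneous w d ∧
    MvPolynomial.eval (c p) G ≠ 0 ∧
    ∀ q ∈ U, MvPolynomial.eval (c q) G ≠ 0 →
      f q = MvPolynomial.eval (c q) F / MvPolynomial.eval (c q) G

/-- The quotient structure: the quotient topology, and a function on the quotient is regular
if and only if its pullback is regular. -/
def FunctionStructure.quotient {P : Type} (S : FunctionStructure P) (r : Setoid P) :
    FunctionStructure (Quotient r) where
  top := S.top.coinduced (Quotient.mk r)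
  IsRegularOn U f := S.IsRegularOn (Quotient.mk r ⁻¹' U) (fun p => f (Quotient.mk r p))

/-- `φ` is a morphism from the open subset `U` of `P` to the open subset `V` of `Q`: it is
continuous and pulls back regular functions to regular functions. -/
structure IsMorphismOn {P Q : Type} (S : FunctionStructure P) (T : FunctionStructure Q)
    (U : Set P) (V : Set Q) (φ : P → Q) : Prop where
  mapsTo : Set.MapsTo φ U V
  isOpen_preimage : ∀ V' ⊆ V, IsOpen[T.top] V' → IsOpen[S.top] (U ∩ φ ⁻¹' V')
  isRegularOn_comp : ∀ V' ⊆ V, IsOpen[T.top] V' → ∀ g : Q → ℂ, T.IsRegularOn V' g →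
    S.IsRegularOn (U ∩ φ ⁻¹' V') (g ∘ φ)

/-- `φ` is an isomorphism from a dense open subset of `P` onto a dense open subset of `Q`. -/
structure IsBirationalEquiv {P Q : Type} (S : FunctionStructure P) (T : FunctionStructure Q)
    (φ : PartialEquiv P Q) : Prop where
  isOpen_source : IsOpen[S.top] φ.source
  dense_source : @Dense P S.top φ.source
  isOpen_target : IsOpen[T.top] φ.target
  dense_target : @Dense Q T.top φ.target
  morphism : IsMorphismOn S T φ.source φ.target φ
  morphism_symm : IsMorphismOn T S φ.target φ.source φ.symm

/-! ### The matrices -/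

/-- The space of `4 × 4` complex matrices, i.e. of bilinear forms `(x, y) ↦ xᵀ M y` on `ℂ⁴`. -/
abbrev Mat4 : Type := Matrix (Fin 4) (Fin 4) ℂ

/-- The symmetric part of a matrix. -/
def symPart (M : Mat4) : Mat4 := (1 / 2 : ℂ) • (M + M.transpose)

/-- The skew-symmetric part of a matrix. -/
def skewPart (M : Mat4) : Mat4 := (1 / 2 : ℂ) • (M - M.transpose)

/-! ### The variety `Z` in `ℙ³ × ℙ³ × ℙ¹` and its quotient by the involution -/

/-- `ℙ³ × ℙ³ × ℙ¹`. -/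
abbrev P3P3P1 : Type := ℙ ℂ (Fin 4 → ℂ) × ℙ ℂ (Fin 4 → ℂ) × ℙ ℂ (Fin 2 → ℂ)

/-- Homogeneous coordinates `x₀, …, x₃; y₀, …, y₃; s, t` on `ℙ³ × ℙ³ × ℙ¹`. -/
def P3P3P1.coords (p : P3P3P1) : Fin 4 ⊕ Fin 4 ⊕ Fin 2 → ℂ :=
  Sum.elim p.1.rep (Sum.elim p.2.1.rep p.2.2.rep)

/-- The tridegrees of the homogeneous coordinates on `ℙ³ × ℙ³ × ℙ¹`. -/
def P3P3P1.weight : Fin 4 ⊕ Fin 4 ⊕ Fin 2 → ℕ × ℕ × ℕ :=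
  Sum.elim (fun _ => (1, 0, 0)) (Sum.elim (fun _ => (0, 1, 0)) (fun _ => (0, 0, 1)))

/-- `ℙ³ × ℙ³ × ℙ¹` as a variety. -/
def P3P3P1.structure : FunctionStructure P3P3P1 :=
  homogeneousStructure P3P3P1.coords P3P3P1.weight

/-- The intersection of the four `(1,1,1)`-divisors `xᵀ (s Aᵢ + t Bᵢ) y = 0`. -/
def divisorIntersection (M : Fin 4 → Mat4) : Set P3P3P1 :=
  {p | ∀ i, p.1.rep ⬝ᵥ (p.2.2.rep 0 • symPart (M i) + p.2.2.rep 1 • skewPart (M i)).mulVec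
    p.2.1.rep = 0}

/-- The component `{(x, x, (0 : 1))}`. -/
def diagonalComponent : Set P3P3P1 :=
  {p | p.1 = p.2.1 ∧ p.2.2.rep 0 = 0}

/-- The residual component `Z`: the Zariski closure of the complement of the component
`{(x, x, (0 : 1))}` in the intersection of the four divisors. -/
def residualComponent (M : Fin 4 → Mat4) : Set P3P3P1 :=
  closure[P3P3P1.structure.top] (divisorIntersection M \ diagonalComponent)

/-- `Z` as a variety, with the structure induced from `ℙ³ × ℙ³ × ℙ¹`. -/
def residualStructure (M : Fin 4 → Mat4) : FunctionStructure (residualComponent M) :=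
  homogeneousStructure (fun p : residualComponent M => P3P3P1.coords p) P3P3P1.weight

/-- The linear map `(s, t) ↦ (s, -t)`. -/
def negSnd : (Fin 2 → ℂ) →ₗ[ℂ] (Fin 2 → ℂ) where
  toFun v := ![v 0, -v 1]
  map_add' v w := by
    ext i; fin_cases i <;> simp [add_comm]
  map_smul' a v := by
    ext i; fin_cases i <;> simp

theorem negSnd_negSnd (v : Fin 2 → ℂ) : negSnd (negSnd v) = v := by
  ext i; fin_cases i <;> simp [negSnd]

theorem negSnd_injective : Function.Injective negSnd :=
  Function.LeftInverse.injective negSnd_negSnd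

/-- The involution `(x, y, (s : t)) ↦ (y, x, (s : -t))`. -/
def tau (p : P3P3P1) : P3P3P1 :=
  (p.2.1, p.1, Projectivization.map negSnd negSnd_injective p.2.2)

theorem tau_tau (p : P3P3P1) : tau (tau p) = p := by
  obtain ⟨x, y, q⟩ := p
  induction q with
  | h v hv => simp [tau, Projectivization.map_mk, negSnd_negSnd]

/-- The relation on `Z` of lying in the same orbit of the involution `tau`. -/
def tauSetoid (M : Fin 4 → Mat4) : Setoid (residualComponent M) where
  r p q := q.1 = p.1 ∨ q.1 = tau p.1
  iseqv :=
    { refl := fun _ => Or.inl rfl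
      symm := by
        rintro p q (h | h)
        · exact Or.inl h.symm
        · exact Or.inr (by rw [h, tau_tau])
      trans := by
        rintro p q r (h | h) (h' | h')
        · exact Or.inl (h'.trans h)
        · exact Or.inr (by rw [h', h])
        · exact Or.inr (by rw [h', h])
        · exact Or.inl (by rw [h', h, tau_tau]) }

/-- The quotient variety `Z / τ`. -/
def quotientStructure (M : Fin 4 → Mat4) : FunctionStructure (Quotient (tauSetoid M)) :=
  (residualStructure M).quotient (tauSetoid M)

/-! ### The variety `X` in the Grassmannian -/

/-- The Grassmannian `Gr(2, ℂ⁴)` of two-dimensional subspaces of `ℂ⁴`. -/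
abbrev Gr24 : Type := {L : Submodule ℂ (Fin 4 → ℂ) // Module.finrank ℂ L = 2}

/-- Plücker coordinates `vᵢ wⱼ - vⱼ wᵢ` with respect to a basis `v, w` of the subspace. -/
def Gr24.pluecker (L : Gr24) : Fin 4 × Fin 4 → ℂ := fun ij =>
  let b := Module.finBasisOfFinrankEq ℂ L.1 L.2
  (b 0).1 ij.1 * (b 1).1 ij.2 - (b 0).1 ij.2 * (b 1).1 ij.1

/-- Restriction of bilinear forms on `ℂ⁴`, given by matrices, to a subspace. -/
def restrictForm (L : Submodule ℂ (Fin 4 → ℂ)) : Mat4 →ₗ[ℂ] LinearMap.BilinForm ℂ L where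
  toFun M := (Matrix.toBilin' M).restrict L
  map_add' M N := by ext; simp
  map_smul' a M := by ext; simp

/-- The variety `X` attached to a space `W` of bilinear forms: the two-dimensional subspaces `L` of
`ℂ⁴` such that the space of restrictions of elements of `W` to `L` has dimension at most three. -/
def determinantalLocus (W : Submodule ℂ Mat4) : Set Gr24 :=
  {L | Module.finrank ℂ (W.map (restrictForm L.1)) ≤ 3}

/-- `X` as a variety, with the structure induced from the Plücker embedding of the Grassmannian. -/
def determinantalStructure (W : Submodule ℂ Mat4) : FunctionStructure (determinantalLocus W) :=
  homogeneousStructure (fun L : determinantalLocus W => Gr24.pluecker L) (fun _ => (1 : ℕ))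

/-- The span of the entries of a tuple of matrices. -/
def spanOf (M : Fin 4 → Mat4) : Submodule ℂ Mat4 := Submodule.span ℂ (Set.range M)

end

/-! ### Density in generic fibres of a polynomial map -/

section GenericFibre

open MvPolynomial

/-! The equations of $Z$ say that every $M_i$, as a linear form on $V\otimes V$, kills the tensor
$s(x\otimes y+y\otimes x)+t(x\otimes y-y\otimes x)=(s+t)\,x\otimes y+(s-t)\,y\otimes x$. On the
other side, $L\in X$ means that the four restrictions, as linear forms on the four-dimensional space
$L\otimes L$, are dependent, so that they kill a nonzero tensor of $L\otimes L$. If the symmetric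
part of that tensor is nondegenerate, it is a product of two independent vectors $x,y$ of $L$,
unique up to order and scale, and the skew part is a multiple of $x\wedge y$; exchanging the two
vectors is $\tau$. Call a point good (`IsGoodPoint`) if $x,y$ are independent, $s\neq0$, and the
$4\times4$ matrix of restrictions (`formMatrix`) has a nonzero adjugate, so that the kernel is a
line. Then `IsGoodPoint.unique` and `exists_isGoodPoint` give a bijection between good points modulo
$\tau$ and the subspaces which they span.

Density of the good loci, the only place where genericity enters: the pairs (matrices, tensor) with
nonzero tensor form an incidence variety whose equations are linear in the matrices. Where one entry
of the tensor is nonzero, these equations can be solved, so the incidence variety is locally the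
image of an affine space. By `exists_generic_dense_in_fibre`, which combines Noether normalization,
going down and the Nullstellensatz, a nonempty open condition on an affine space is dense in the
generic fibres of a polynomial map. One explicit sample shows that the good conditions can be met.
This gives density in $Z$, and also in $X$ after a kernel vector is added to the variables.

Regularity of the inverse: the vectors $x,y$ are not functions on $X$, since finding them takes the
square root of a discriminant. The kernel tensor does depend regularly on $L$, being read off from
the adjugate. Therefore any polynomial in suitably rescaled coordinates of a good point equals
$P+QE$, with $P,Q$ regular on $X$, $E^2$ regular and $E$ changing sign under $\tau$
(`exists_eval_scaledCoords`). Comparing the two points of an orbit separates $P$ from $Q$. This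
shows that the inverse is continuous and that functions regular on $Z/\tau$ become regular on $X$.
-/

/-- Noether normalization over a domain: a finitely generated extension domain is, up to
denominators from the base, integral over a polynomial ring. -/
theorem exists_injective_aeval_isIntegral_smul (R A : Type) [CommRing R] [IsDomain R] [CommRing A]
    [IsDomain A] [Algebra R A] [FaithfulSMul R A] [Algebra.FiniteType R A] :
    ∃ (n : ℕ) (g : MvPolynomial (Fin n) R →ₐ[R] A), Function.Injective g ∧
      ∀ a : A, ∃ c : R, c ≠ 0 ∧ g.toRingHom.IsIntegralElem (c • a) := by
  classical
  let K := FractionRing R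
  let L := FractionRing A
  let : Algebra K L := FractionRing.liftAlgebra R L
  obtain ⟨s, hs⟩ := (inferInstance : Algebra.FiniteType R A)
  -- `S` is `A` with the nonzero elements of `R` inverted: a finitely generated algebra over the
  -- field `K`, to which the usual Noether normalization applies.
  let S : Subalgebra K L := Algebra.adjoin K (algebraMap A L '' s)
  have hS : ∀ a : A, algebraMap A L a ∈ S := by
    intro a
    have ha : a ∈ Algebra.adjoin R (s : Set A) := by rw [hs]; trivial
    induction ha using Algebra.adjoin_induction with
    | mem x hx => exact Algebra.subset_adjoin ⟨x, hx, rfl⟩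
    | algebraMap r =>
      rw [← IsScalarTower.algebraMap_apply R A L, IsScalarTower.algebraMap_apply R K L]
      exact S.algebraMap_mem _
    | add x y _ _ hx hy => rw [map_add]; exact S.add_mem hx hy
    | mul x y _ _ hx hy => rw [map_mul]; exact S.mul_mem hx hy
  have hden : ∀ z ∈ S, ∃ (d : R) (a : A), d ≠ 0 ∧
      algebraMap R L d * z = algebraMap A L a := by
    intro z hz
    induction hz using Algebra.adjoin_induction with
    | mem x hx =>
      obtain ⟨a, _, rfl⟩ := hx
      exact ⟨1, a, one_ne_zero, by simp⟩
    | algebraMap r =>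
      obtain ⟨⟨x, y⟩, h⟩ := IsLocalization.surj (nonZeroDivisors R) r
      refine ⟨y, algebraMap R A x, nonZeroDivisors.ne_zero y.2, ?_⟩
      rw [← IsScalarTower.algebraMap_apply R A L, IsScalarTower.algebraMap_apply R K L,
        IsScalarTower.algebraMap_apply R K L, ← map_mul, ← h, mul_comm]
    | add x y _ _ hx hy =>
      obtain ⟨d, a, hd, h⟩ := hx
      obtain ⟨d', a', hd', h'⟩ := hy
      refine ⟨d * d', algebraMap R A d' * a + algebraMap R A d * a', mul_ne_zero hd hd', ?_⟩
      simp only [map_mul, map_add, ← h, ← h', ← IsScalarTower.algebraMap_apply R A L]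
      ring
    | mul x y _ _ hx hy =>
      obtain ⟨d, a, hd, h⟩ := hx
      obtain ⟨d', a', hd', h'⟩ := hy
      refine ⟨d * d', a * a', mul_ne_zero hd hd', ?_⟩
      simp only [map_mul, ← h, ← h']
      ring
  have : Algebra.FiniteType K S := by
    have := (Subalgebra.fg_iff_finiteType S).1
      ⟨s.image (algebraMap A L), by rw [Finset.coe_image]⟩
    exact this
  obtain ⟨n, g, hg, hgi⟩ := exists_integral_inj_algHom_of_fg K S
  choose d a hd ha using fun i : Fin n => hden (g (X i)) (g (X i)).2
  have hRL : Function.Injective (algebraMap R L) := FaithfulSMul.algebraMap_injective R L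
  have hAL : Function.Injective (algebraMap A L) := FaithfulSMul.algebraMap_injective A L
  have hRK : Function.Injective (algebraMap R K) := FaithfulSMul.algebraMap_injective R K
  have hdK : ∀ i, algebraMap R K (d i) ≠ 0 := fun i => by
    simpa using hd i
  -- Multiplying the variables by the denominators `d i` moves their images into `A`. This is an
  -- automorphism over `K`, so injectivity and integrality survive.
  let sc : MvPolynomial (Fin n) K →ₐ[K] MvPolynomial (Fin n) K :=
    aeval fun i => C (algebraMap R K (d i)) * X i
  let sc' : MvPolynomial (Fin n) K →ₐ[K] MvPolynomial (Fin n) K :=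
    aeval fun i => C (algebraMap R K (d i))⁻¹ * X i
  have h1 : sc.comp sc' = AlgHom.id K _ := by
    ext i : 1
    simp only [sc, sc', AlgHom.comp_apply, aeval_X, map_mul, AlgHom.id_apply]
    rw [show (aeval fun i => C (algebraMap R K (d i)) * X i) (C (algebraMap R K (d i))⁻¹)
      = (C (algebraMap R K (d i))⁻¹ : MvPolynomial (Fin n) K) from AlgHom.commutes _ _,
      ← mul_assoc, ← C_mul, inv_mul_cancel₀ (hdK i), C_1, one_mul]
  have h2 : sc'.comp sc = AlgHom.id K _ := by
    ext i : 1
    simp only [sc, sc', AlgHom.comp_apply, aeval_X, map_mul, AlgHom.id_apply]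
    rw [show (aeval fun i => C (algebraMap R K (d i))⁻¹ * X i) (C (algebraMap R K (d i)))
      = (C (algebraMap R K (d i)) : MvPolynomial (Fin n) K) from AlgHom.commutes _ _,
      ← mul_assoc, ← C_mul, mul_inv_cancel₀ (hdK i), C_1, one_mul]
  have hsc : Function.Bijective sc :=
    ⟨Function.LeftInverse.injective (g := sc') fun x => DFunLike.congr_fun h2 x,
      Function.RightInverse.surjective (g := sc') fun x => DFunLike.congr_fun h1 x⟩
  let gK := g.comp sc
  have hgK : Function.Injective gK := hg.comp hsc.1
  have hgKi : gK.toRingHom.IsIntegral :=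
    RingHom.IsIntegral.trans sc.toRingHom g.toRingHom
      (RingHom.isIntegral_of_surjective _ hsc.2) hgi
  let gR : MvPolynomial (Fin n) R →ₐ[R] A := aeval a
  have hcompat : ∀ p, algebraMap A L (gR p) = (gK (map (algebraMap R K) p) : L) := by
    intro p
    induction p using MvPolynomial.induction_on with
    | C r =>
      rw [map_C]
      have e1 : gR (C r) = algebraMap R A r := gR.commutes r
      have e2 : gK (C (algebraMap R K r)) = algebraMap K S (algebraMap R K r) := gK.commutes _
      rw [e1, e2, ← IsScalarTower.algebraMap_apply R A L, IsScalarTower.algebraMap_apply R K L]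
      rfl
    | add p q hp hq => simp only [map_add, hp, hq, Subalgebra.coe_add]
    | mul_X p i hp =>
      simp only [map_mul, hp, map_X, Subalgebra.coe_mul]
      congr 1
      have e1 : gK (X i) = algebraMap K S (algebraMap R K (d i)) * g (X i) := by
        simp only [gK, sc, AlgHom.comp_apply, aeval_X, map_mul]
        congr 1
        exact g.commutes _
      rw [e1, aeval_X, ← ha i, Subalgebra.coe_mul, IsScalarTower.algebraMap_apply R K L]
      rfl
  refine ⟨n, gR, ?_, ?_⟩
  · intro p q hpq
    have : gK (map (algebraMap R K) p) = gK (map (algebraMap R K) q) := by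
      apply Subtype.ext
      rw [← hcompat, ← hcompat, hpq]
    exact map_injective _ hRK (hgK this)
  · intro x
    let : Algebra (MvPolynomial (Fin n) K) L := (S.val.toRingHom.comp gK.toRingHom).toAlgebra
    let : Algebra (MvPolynomial (Fin n) R) A := gR.toRingHom.toAlgebra
    let _ : Algebra (MvPolynomial (Fin n) R) (MvPolynomial (Fin n) K) := algebraMvPolynomial
    have hYL : ∀ p : MvPolynomial (Fin n) R, algebraMap (MvPolynomial (Fin n) R) L p =
        algebraMap A L (gR p) := IsScalarTower.algebraMap_apply (MvPolynomial (Fin n) R) A L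
    have : IsScalarTower (MvPolynomial (Fin n) R) (MvPolynomial (Fin n) K) L :=
      IsScalarTower.of_algebraMap_eq fun p => (hYL p).trans (hcompat p)
    have hx : IsIntegral (MvPolynomial (Fin n) K) (algebraMap A L x) := by
      have := (hgKi ⟨algebraMap A L x, hS x⟩).map S.val.toRingHom
      exact this
    -- `K[X]` is the localization of `R[X]` at the nonzero constants, so the denominator can be
    -- chosen in `R`.
    obtain ⟨⟨m, hm⟩, hmi⟩ := hx.exists_multiple_integral_of_isLocalization
      ((nonZeroDivisors R).map (C (σ := Fin n))) 
    obtain ⟨c, hc, rfl⟩ := hm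
    refine ⟨c, nonZeroDivisors.ne_zero hc, ?_⟩
    have e : (C c : MvPolynomial (Fin n) R) • algebraMap A L x = algebraMap A L (c • x) := by
      rw [Algebra.smul_def, Algebra.smul_def, map_mul]
      congr 1
      change algebraMap A L (gR (C c)) = _
      rw [show gR (C c) = algebraMap R A c from gR.commutes c]
    have := hmi
    rw [Submonoid.smul_def] at this
    change IsIntegral _ ((C c : MvPolynomial (Fin n) R) • algebraMap A L x) at this
    rw [e, isIntegral_algebraMap_iff hAL] at this
    exact this

theorem eval_aeval {σ τ : Type} (v : τ → ℂ) (g : σ → MvPolynomial τ ℂ) (F : MvPolynomial σ ℂ) :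
    eval v (aeval g F) = eval (fun i => eval v (g i)) F := by
  have : (eval v).comp (aeval g).toRingHom = eval (fun i => eval v (g i)) := by
    refine MvPolynomial.ringHom_ext (fun r => ?_) fun i => ?_
    · rw [RingHom.comp_apply, eval_C, show (aeval g).toRingHom (C r) = C r from
        (aeval g).commutes r, eval_C]
    · rw [RingHom.comp_apply, eval_X, show (aeval g).toRingHom (X i) = g i from aeval_X g i]
  exact DFunLike.congr_fun this F

/-- For a polynomial map `f : ℂ^τ → ℂ^σ` and a nonzero polynomial `δ`, the locus `δ ≠ 0` is dense
in the generic fibre of `f`. -/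
theorem exists_generic_dense_in_fibre {σ τ : Type} [Finite σ] [Finite τ]
    (f : σ → MvPolynomial τ ℂ) (δ : MvPolynomial τ ℂ) (hδ : δ ≠ 0) :
    ∃ P : MvPolynomial σ ℂ, P ≠ 0 ∧ ∀ a : τ → ℂ, eval (fun i => eval a (f i)) P ≠ 0 →
      ∀ F : MvPolynomial τ ℂ, eval a F ≠ 0 →
        ∃ b : τ → ℂ, (∀ i, eval b (f i) = eval a (f i)) ∧ eval b F ≠ 0 ∧ eval b δ ≠ 0 := by
  classical
  let R := MvPolynomial σ ℂ
  let A := MvPolynomial τ ℂ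
  let φ : R →ₐ[ℂ] A := aeval f
  have hev : ∀ (a : τ → ℂ) (r : R), eval a (φ r) = eval (fun i => eval a (f i)) r :=
    fun a r => eval_aeval a f r
  by_cases hφ : Function.Injective φ
  swap
  -- If `f` is not dominant, a nonzero `P` vanishing on its image makes the claim vacuous.
  · obtain ⟨P, hP, hP0⟩ : ∃ P, φ P = 0 ∧ P ≠ 0 := by
      by_contra! h
      exact hφ ((injective_iff_map_eq_zero φ).2 h)
    refine ⟨P, hP0, fun a ha => absurd ?_ ha⟩
    rw [← hev, hP, map_zero]
  let _ : Algebra R A := φ.toRingHom.toAlgebra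
  have : FaithfulSMul R A := (faithfulSMul_iff_algebraMap_injective R A).2 hφ
  have : IsScalarTower ℂ R A := IsScalarTower.of_algebraMap_eq fun x => (φ.commutes x).symm
  have : Algebra.FiniteType R A := Algebra.FiniteType.of_restrictScalars_finiteType ℂ R A
  obtain ⟨n, g, hg, hint⟩ := exists_injective_aeval_isIntegral_smul R A
  let Y := MvPolynomial (Fin n) R
  let _ : Algebra Y A := g.toRingHom.toAlgebra
  have : FaithfulSMul Y A := (faithfulSMul_iff_algebraMap_injective Y A).2 hg
  have hYA : ∀ y, algebraMap Y A y = g y := fun _ => rfl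
  have hYC : ∀ r : R, algebraMap Y A (C r) = φ r := fun r => g.commutes r
  choose c hc0 hc using hint
  let _ := Fintype.ofFinite τ
  -- One denominator for all the variables: once `c0` is inverted, all of `A` is integral over `Y`.
  let c0 : R := ∏ j : τ, c (X j)
  have hc00 : c0 ≠ 0 := Finset.prod_ne_zero_iff.2 fun j _ => hc0 _
  let A0 := integralClosure Y A
  have hφA0 : ∀ r, φ r ∈ A0 := fun r => hYC r ▸ A0.algebraMap_mem (C r)
  have hX : ∀ j : τ, φ c0 * X j ∈ A0 := by
    intro j
    have h1 : φ (c (X j)) * X j ∈ A0 := hc (X j)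
    have h2 : φ c0 * X j = φ (∏ i ∈ Finset.univ.erase j, c (X i)) * (φ (c (X j)) * X j) := by
      rw [← mul_assoc, ← map_mul, Finset.prod_erase_mul _ _ (Finset.mem_univ j)]
    rw [h2]
    exact A0.mul_mem (hφA0 _) h1
  have hpow : ∀ a : A, ∃ k : ℕ, φ c0 ^ k * a ∈ A0 := by
    intro a
    induction a using MvPolynomial.induction_on with
    | C r =>
      refine ⟨0, ?_⟩
      have : (C r : A) = φ (C r) := (φ.commutes r).symm
      rw [pow_zero, one_mul, this]
      exact hφA0 _
    | add p q hp hq =>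
      obtain ⟨k, hk⟩ := hp
      obtain ⟨l, hl⟩ := hq
      refine ⟨k + l, ?_⟩
      have : φ c0 ^ (k + l) * (p + q) = φ c0 ^ l * (φ c0 ^ k * p) + φ c0 ^ k * (φ c0 ^ l * q) := by
        ring
      rw [this]
      exact A0.add_mem (A0.mul_mem (A0.pow_mem (hφA0 _) _) hk)
        (A0.mul_mem (A0.pow_mem (hφA0 _) _) hl)
    | mul_X p j hp =>
      obtain ⟨k, hk⟩ := hp
      refine ⟨k + 1, ?_⟩
      have : φ c0 ^ (k + 1) * (p * X j) = φ c0 ^ k * p * (φ c0 * X j) := by ring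
      rw [this]
      exact A0.mul_mem hk (hX j)
  have hφc0 : φ c0 ≠ 0 := fun h => hc00 (hφ (by rw [h, map_zero]))
  obtain ⟨k, hk⟩ := hpow δ
  let δ0 : A0 := ⟨φ c0 ^ k * δ, hk⟩
  have hδ0 : δ0 ≠ 0 := by
    intro h
    exact mul_ne_zero (pow_ne_zero k hφc0) hδ (congrArg Subtype.val h)
  obtain ⟨y, hy0, hy⟩ : ∃ y : Y, y ≠ 0 ∧ δ0 ∣ algebraMap Y A0 y := by
    have hi : IsIntegral Y δ0 := Algebra.IsIntegral.isIntegral δ0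
    obtain ⟨y, hy0, hy⟩ := hi.isAlgebraic.exists_nonzero_dvd (mem_nonZeroDivisors_of_ne_zero hδ0)
    exact ⟨y, hy0, hy⟩
  obtain ⟨m, hm⟩ : ∃ m, coeff m y ≠ 0 := by
    by_contra! h
    exact hy0 (MvPolynomial.ext _ _ fun m => by rw [h m, coeff_zero])
  -- Where `c0` does not vanish, the integrality survives specialization; where the coefficient does
  -- not vanish, neither does the specialization of `y`, a nonzero multiple of `δ0` in `Y`.
  refine ⟨c0 * coeff m y, mul_ne_zero hc00 hm, fun a ha F hF => ?_⟩
  let ε : R →+* ℂ := eval fun i => eval a (f i)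
  rw [map_mul] at ha
  have hac : ε c0 ≠ 0 := left_ne_zero_of_mul ha
  have ham : ε (coeff m y) ≠ 0 := right_ne_zero_of_mul ha
  -- `p1` is the ideal of the affine space lying over the value `f(a)`, and `q0` that of the point
  -- `a`.
  let p1 : Ideal Y := RingHom.ker (MvPolynomial.map (σ := Fin n) ε)
  let q0 : Ideal A0 := RingHom.ker ((eval a).comp A0.val.toRingHom)
  have hp1 : p1.IsPrime := RingHom.ker_isPrime _
  have hq0 : q0.IsPrime := RingHom.ker_isPrime _
  have hle : p1 ≤ q0.under Y := by
    intro z hz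
    have hcomp : (eval a).comp (algebraMap Y A) =
        (eval fun i => eval a (g (X i))).comp (MvPolynomial.map ε) := by
      apply MvPolynomial.ringHom_ext
      · intro r
        rw [RingHom.comp_apply, hYC, hev, RingHom.comp_apply, map_C, eval_C]
      · intro i
        rw [RingHom.comp_apply, RingHom.comp_apply, map_X, eval_X, hYA]
    have h0 : MvPolynomial.map ε z = 0 := hz
    change eval a (algebraMap Y A z) = 0
    have := DFunLike.congr_fun hcomp z
    rw [RingHom.comp_apply, RingHom.comp_apply, h0, map_zero] at this
    exact this
  have : FaithfulSMul Y A0 := (faithfulSMul_iff_algebraMap_injective Y A0).2 fun u v h =>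
    FaithfulSMul.algebraMap_injective Y A (congrArg Subtype.val h)
  have : UniqueFactorizationMonoid Y := inferInstance
  have : IsIntegrallyClosed Y := inferInstance
  -- Going down, available because `Y` is normal: an irreducible closed set through `a` that lies
  -- over the whole affine space of `p1`.
  obtain ⟨q1, hq10, hq1, hq1p⟩ := Ideal.exists_ideal_le_liesOver_of_le (S := A0) q0 hle
  have hmem1 : ∀ z : Y, algebraMap Y A0 z ∈ q1 ↔ z ∈ p1 := fun z => by
    rw [hq1p.over]; rfl
  let P0 : A0 := ⟨φ c0, hφA0 c0⟩
  have hP0q0 : P0 ∉ q0 := by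
    intro h
    have h' : eval a (φ c0) = 0 := h
    rw [hev] at h'
    exact hac h'
  have hP0 : P0 ∉ q1 := fun h => hP0q0 (hq10 h)
  have hP0k : ∀ k, P0 ^ k ∉ q1 := fun k h => hP0 (hq1.mem_of_pow_mem k h)
  have hδ1 : δ0 ∉ q1 := by
    intro h
    have h1 : y ∈ p1 := (hmem1 y).1 (q1.mem_of_dvd hy h)
    have h2 : MvPolynomial.map ε y = 0 := h1
    have h3 := congrArg (coeff m) h2
    rw [coeff_map, coeff_zero] at h3
    exact ham h3
  -- Since `c0` is not in `q1`, the prime `q1` extends to `A` by allowing powers of `c0` as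
  -- denominators.
  let Q : Ideal A :=
    { carrier := {x | ∃ (k : ℕ) (z : A0), z ∈ q1 ∧ (z : A) = φ c0 ^ k * x}
      zero_mem' := ⟨0, 0, q1.zero_mem, by simp⟩
      add_mem' := by
        rintro x x' ⟨k, z, hz, e⟩ ⟨k', z', hz', e'⟩
        refine ⟨k + k', P0 ^ k' * z + P0 ^ k * z',
          q1.add_mem (q1.mul_mem_left _ hz) (q1.mul_mem_left _ hz'), ?_⟩
        simp only [Subalgebra.coe_add, Subalgebra.coe_mul, Subalgebra.coe_pow, e, e', P0]
        ring
      smul_mem' := by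
        rintro b x ⟨k, z, hz, e⟩
        obtain ⟨l, hl⟩ := hpow b
        refine ⟨l + k, ⟨_, hl⟩ * z, q1.mul_mem_left _ hz, ?_⟩
        simp only [Subalgebra.coe_mul, e, smul_eq_mul]
        ring }
  have hQmem : ∀ z : A0, (z : A) ∈ Q ↔ z ∈ q1 := by
    intro z
    constructor
    · rintro ⟨k, w, hw, e⟩
      have : w = P0 ^ k * z := Subtype.ext e
      rw [this] at hw
      exact (hq1.mem_or_mem hw).resolve_left (hP0k k)
    · intro hz
      exact ⟨0, z, hz, by simp⟩
  have hQ : Q.IsPrime := by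
    refine ⟨fun h => ?_, fun {x x'} h => ?_⟩
    · have h1 : ((1 : A0) : A) ∈ Q := by rw [h]; trivial
      exact hq1.one_notMem ((hQmem 1).1 h1)
    · obtain ⟨k, hk⟩ := hpow x
      obtain ⟨l, hl⟩ := hpow x'
      have h1 : ((⟨_, hk⟩ * ⟨_, hl⟩ : A0) : A) ∈ Q := by
        have : ((⟨_, hk⟩ * ⟨_, hl⟩ : A0) : A) = φ c0 ^ (k + l) * (x * x') := by
          simp only [Subalgebra.coe_mul]; ring
        rw [this]
        exact Q.mul_mem_left _ h
      refine (hq1.mem_or_mem ((hQmem _).1 h1)).imp (fun h => ?_) (fun h => ?_)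
      · exact ⟨k, _, h, rfl⟩
      · exact ⟨l, _, h, rfl⟩
  have hFQ : F ∉ Q := by
    rintro ⟨k, z, hz, e⟩
    have h1 : eval a (z : A) = 0 := hq10 hz
    rw [e, map_mul, map_pow, hev] at h1
    exact mul_ne_zero (pow_ne_zero _ hac) hF h1
  have hδQ : δ ∉ Q := by
    intro h
    exact hδ1 ((hQmem δ0).1 (Q.mul_mem_left _ h))
  have hFδ : F * δ ∉ Q := fun h => (hQ.mem_or_mem h).elim hFQ hδQ
  -- Nullstellensatz: as `F * δ` is not in the prime `Q`, it is nonzero at some zero `b` of `Q`.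
  -- Such zeros stay in the fibre because `Q` contains the differences between the `f i` and their
  -- values at `a`.
  rw [← IsPrime.vanishingIdeal_zeroLocus (K := ℂ) Q, mem_vanishingIdeal_iff] at hFδ
  push Not at hFδ
  obtain ⟨b, hb, hbe⟩ := hFδ
  rw [map_mul] at hbe
  refine ⟨b, fun i => ?_, left_ne_zero_of_mul hbe, right_ne_zero_of_mul hbe⟩
  have hmem : φ (X i - C (ε (X i))) ∈ Q := by
    rw [← hYC, IsScalarTower.algebraMap_apply Y A0 A]
    refine (hQmem _).2 ((hmem1 _).2 ?_)
    change MvPolynomial.map ε (C (X i - C (ε (X i)))) = 0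
    have h0 : ε (X i - C (ε (X i))) = 0 := by
      rw [map_sub, sub_eq_zero]
      exact (eval_C (ε (X i))).symm
    rw [map_C, h0, C_0]
  have h1 := hb _ hmem
  change eval b (φ _) = 0 at h1
  rw [hev, map_sub, eval_C, eval_X, sub_eq_zero] at h1
  exact h1.trans (eval_X (f := fun i => eval a (f i)) i)

end GenericFibre

/-! ### Multihomogeneous forms, Zariski topology and regular functions -/

section Homogeneous

open MvPolynomial

variable {σ σ' D D' : Type} [AddCommMonoid D] [AddCommMonoid D']

/-- Substituting weighted homogeneous polynomials into a weighted homogeneous polynomial. -/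
theorem isWeightedHomogeneous_aeval {w : σ → D} {w' : σ' → D'} (ψ : D →+ D')
    {g : σ → MvPolynomial σ' ℂ} (hg : ∀ i, (g i).IsWeightedHomogeneous w' (ψ (w i)))
    {F : MvPolynomial σ ℂ} {d : D} (hF : F.IsWeightedHomogeneous w d) :
    (aeval g F).IsWeightedHomogeneous w' (ψ d) := by
  rw [aeval_def, eval₂_eq]
  refine IsWeightedHomogeneous.sum _ _ _ fun m hm => ?_
  have hmd : Finsupp.weight w m = d := hF (mem_support_iff.1 hm)
  refine IsWeightedHomogeneous.C_mul ?_ _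
  have := IsWeightedHomogeneous.prod m.support (fun i => g i ^ m i) (fun i => m i • ψ (w i))
    (w := w') fun i _ => (hg i).pow (m i)
  convert this using 1
  rw [← hmd, Finsupp.weight_apply, Finsupp.sum, map_sum]
  simp

/-- The effect of rescaling the variables on the values of a weighted homogeneous polynomial. -/
theorem eval_mul_of_isWeightedHomogeneous {w : σ → D} (χ : Multiplicative D →* ℂ) (v : σ → ℂ)
    {F : MvPolynomial σ ℂ} {d : D} (hF : F.IsWeightedHomogeneous w d) :
    eval (fun i => χ (Multiplicative.ofAdd (w i)) * v i) F =
      χ (Multiplicative.ofAdd d) * eval v F := by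
  rw [eval_eq, eval_eq, Finset.mul_sum]
  refine Finset.sum_congr rfl fun m hm => ?_
  have hmd : Finsupp.weight w m = d := hF (mem_support_iff.1 hm)
  simp only [mul_pow, Finset.prod_mul_distrib]
  rw [← hmd, Finsupp.weight_apply, Finsupp.sum, ofAdd_sum, map_prod]
  simp only [ofAdd_nsmul, map_pow]
  ring

variable {P : Type} (c : P → σ → ℂ) (w : σ → D)

/-- A product of homogeneous forms is homogeneous, so the generating sets are closed under finite
intersection and form a basis. -/
theorem isOpen_homogeneousStructure_iff {O : Set P} :
    IsOpen[(homogeneousStructure c w).top] O ↔ ∀ p ∈ O, ∃ (d : D) (F : MvPolynomial σ ℂ),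
      F.IsWeightedHomogeneous w d ∧ eval (c p) F ≠ 0 ∧ ∀ q, eval (c q) F ≠ 0 → q ∈ O := by
  constructor
  · intro h
    induction h with
    | basic s hs =>
      obtain ⟨d, F, hF, rfl⟩ := hs
      exact fun p hp => ⟨d, F, hF, hp, fun _ h => h⟩
    | univ => exact fun p _ => ⟨0, 1, isWeightedHomogeneous_one _ _, by simp, fun _ _ => trivial⟩
    | inter s t _ _ hs ht =>
      rintro p ⟨hps, hpt⟩
      obtain ⟨d, F, hF, hFp, hFs⟩ := hs p hps
      obtain ⟨e, G, hG, hGp, hGt⟩ := ht p hpt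
      refine ⟨d + e, F * G, hF.mul hG, by simpa using ⟨hFp, hGp⟩, fun q hq => ?_⟩
      rw [map_mul] at hq
      exact ⟨hFs q (left_ne_zero_of_mul hq), hGt q (right_ne_zero_of_mul hq)⟩
    | sUnion S _ ih =>
      rintro p ⟨s, hs, hp⟩
      obtain ⟨d, F, hF, hFp, hFs⟩ := ih s hs p hp
      exact ⟨d, F, hF, hFp, fun q hq => ⟨s, hs, hFs q hq⟩⟩
  · intro h
    choose! d F hF hFp hFO using h
    have : O = ⋃ p ∈ O, {q | eval (c q) (F p) ≠ 0} := by
      ext q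
      simp only [Set.mem_iUnion, Set.mem_ofPred_eq, exists_prop]
      exact ⟨fun hq => ⟨q, hq, hFp q hq⟩, fun ⟨p, hp, hq⟩ => hFO p hp q hq⟩
    rw [this]
    let _ := (homogeneousStructure c w).top
    exact isOpen_biUnion fun p hp =>
      TopologicalSpace.isOpen_generateFrom_of_mem ⟨d p, F p, hF p hp, rfl⟩

theorem isOpen_eval_ne_zero {F : MvPolynomial σ ℂ} {d : D} (hF : F.IsWeightedHomogeneous w d) :
    IsOpen[(homogeneousStructure c w).top] {p | eval (c p) F ≠ 0} :=
  (isOpen_homogeneousStructure_iff c w).2 fun _ hp => ⟨d, F, hF, hp, fun _ h => h⟩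

/-- The functions which, near the point `p`, are quotients of homogeneous polynomials of the same
degree. -/
def regularAt (p : P) : Subalgebra ℂ (P → ℂ) where
  carrier := {h | ∃ (d : D) (F G : MvPolynomial σ ℂ), F.IsWeightedHomogeneous w d ∧
    G.IsWeightedHomogeneous w d ∧ eval (c p) G ≠ 0 ∧
    ∀ q, eval (c q) G ≠ 0 → h q = eval (c q) F / eval (c q) G}
  mul_mem' := by
    rintro h h' ⟨d, F, G, hF, hG, hp, e⟩ ⟨d', F', G', hF', hG', hp', e'⟩
    refine ⟨d + d', F * F', G * G', hF.mul hF', hG.mul hG', by simpa using ⟨hp, hp'⟩,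
      fun q hq => ?_⟩
    rw [map_mul] at hq
    rw [Pi.mul_apply, e q (left_ne_zero_of_mul hq), e' q (right_ne_zero_of_mul hq), map_mul,
      map_mul, div_mul_div_comm]
  add_mem' := by
    rintro h h' ⟨d, F, G, hF, hG, hp, e⟩ ⟨d', F', G', hF', hG', hp', e'⟩
    refine ⟨d + d', F * G' + G * F', G * G', (hF.mul hG').add (hG.mul hF'), hG.mul hG',
      by simpa using ⟨hp, hp'⟩, fun q hq => ?_⟩
    rw [map_mul] at hq
    rw [Pi.add_apply, e q (left_ne_zero_of_mul hq), e' q (right_ne_zero_of_mul hq), map_mul,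
      map_add, map_mul, map_mul, div_add_div _ _ (left_ne_zero_of_mul hq)
        (right_ne_zero_of_mul hq)]
  algebraMap_mem' r := ⟨0, C r, 1, isWeightedHomogeneous_C _ _, isWeightedHomogeneous_one _ _,
    by simp, fun q _ => by simp⟩

variable {c w}

theorem div_mem_regularAt {p : P} {F G : MvPolynomial σ ℂ} {d : D}
    (hF : F.IsWeightedHomogeneous w d) (hG : G.IsWeightedHomogeneous w d)
    (hp : eval (c p) G ≠ 0) :
    (fun q => eval (c q) F / eval (c q) G) ∈ regularAt c w p :=
  ⟨d, F, G, hF, hG, hp, fun _ _ => rfl⟩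

theorem inv_mem_regularAt {p : P} {h : P → ℂ} (hh : h ∈ regularAt c w p) (hp : h p ≠ 0) :
    h⁻¹ ∈ regularAt c w p := by
  obtain ⟨d, F, G, hF, hG, hGp, e⟩ := hh
  have hFp : eval (c p) F ≠ 0 := fun h0 => hp (by rw [e p hGp, h0, zero_div])
  -- The inverse is `G / F`, but `h` is known to be `F / G` only where `G` is nonzero; the extra
  -- factor `G` confines the claim to those points.
  refine ⟨d + d, G * G, F * G, hG.mul hG, hF.mul hG, by simpa using ⟨hFp, hGp⟩, fun q hq => ?_⟩
  rw [map_mul] at hq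
  rw [Pi.inv_apply, e q (right_ne_zero_of_mul hq), map_mul, map_mul, inv_div,
    mul_div_mul_right _ _ (right_ne_zero_of_mul hq)]

theorem exists_isOpen_ne_zero_of_mem_regularAt {p : P} {h : P → ℂ} (hh : h ∈ regularAt c w p)
    (hp : h p ≠ 0) :
    ∃ O, IsOpen[(homogeneousStructure c w).top] O ∧ p ∈ O ∧ ∀ q ∈ O, h q ≠ 0 := by
  obtain ⟨d, F, G, hF, hG, hGp, e⟩ := hh
  have hFp : eval (c p) F ≠ 0 := fun h0 => hp (by rw [e p hGp, h0, zero_div])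
  refine ⟨_, isOpen_eval_ne_zero c w (hF.mul hG), by simpa using ⟨hFp, hGp⟩, fun q hq => ?_⟩
  rw [Set.mem_ofPred_eq, map_mul] at hq
  rw [e q (right_ne_zero_of_mul hq)]
  exact div_ne_zero (left_ne_zero_of_mul hq) (right_ne_zero_of_mul hq)

/-- Regularity asks for a formula valid wherever its denominator is nonzero. Multiplying numerator
and denominator by a form that vanishes outside `O` discards the points where `f` and `h` may
differ. -/
theorem isRegularOn_of_eqOn_regularAt {U : Set P} {f : P → ℂ}
    (hf : ∀ p ∈ U, ∃ h ∈ regularAt c w p, ∃ O, IsOpen[(homogeneousStructure c w).top] O ∧ p ∈ O ∧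
      ∀ q ∈ U ∩ O, f q = h q) :
    (homogeneousStructure c w).IsRegularOn U f := by
  intro p hp
  obtain ⟨h, ⟨d, F, G, hF, hG, hGp, e⟩, O, hO, hpO, hfO⟩ := hf p hp
  obtain ⟨d', N, hN, hNp, hNO⟩ := (isOpen_homogeneousStructure_iff c w).1 hO p hpO
  refine ⟨d + d', F * N, G * N, hF.mul hN, hG.mul hN, by simpa using ⟨hGp, hNp⟩,
    fun q hq hqG => ?_⟩
  rw [map_mul] at hqG
  rw [hfO q ⟨hq, hNO q (right_ne_zero_of_mul hqG)⟩, e q (left_ne_zero_of_mul hqG), map_mul,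
    map_mul, mul_div_mul_right _ _ (right_ne_zero_of_mul hqG)]

end Homogeneous

/-! ### Kernel tensors of the forms restricted to a two-dimensional subspace -/

section BilinearForms

open Matrix

/-- The values of the forms `M i` on the pairs `(x, x)`, `(x, y)`, `(y, x)`, `(y, y)`. -/
def formMatrix (M : Fin 4 → Mat4) (x y : Fin 4 → ℂ) : Mat4 :=
  of fun i => ![x ⬝ᵥ M i *ᵥ x, x ⬝ᵥ M i *ᵥ y, y ⬝ᵥ M i *ᵥ x, y ⬝ᵥ M i *ᵥ y]

theorem dotProduct_symPart_add_skewPart (M : Mat4) (x y : Fin 4 → ℂ) (s t : ℂ) :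
    x ⬝ᵥ (s • symPart M + t • skewPart M) *ᵥ y =
      (1 / 2) * ((s + t) * (x ⬝ᵥ M *ᵥ y) + (s - t) * (y ⬝ᵥ M *ᵥ x)) := by
  have h : y ⬝ᵥ M *ᵥ x = x ⬝ᵥ Mᵀ *ᵥ y := by
    rw [mulVec_transpose, dotProduct_comm x, dotProduct_mulVec]
  rw [h]
  simp only [symPart, skewPart, add_mulVec, sub_mulVec, smul_mulVec, dotProduct_add,
    dotProduct_sub, dotProduct_smul, smul_eq_mul]
  ring

theorem formMatrix_mulVec_apply (M : Fin 4 → Mat4) (x y : Fin 4 → ℂ) (v : Fin 4 → ℂ) (i : Fin 4) :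
    (formMatrix M x y *ᵥ v) i = x ⬝ᵥ M i *ᵥ x * v 0 + x ⬝ᵥ M i *ᵥ y * v 1 +
      y ⬝ᵥ M i *ᵥ x * v 2 + y ⬝ᵥ M i *ᵥ y * v 3 := by
  simp [formMatrix, mulVec, dotProduct, Fin.sum_univ_four]

/-- The matrix of the tensor square of a change of basis of a two-dimensional space. -/
def tensorSquare (a b c d : ℂ) : Mat4 :=
  !![a * a, a * c, c * a, c * c; a * b, a * d, c * b, c * d;
    b * a, b * c, d * a, d * c; b * b, b * d, d * b, d * d]

theorem formMatrix_change_of_basis (M : Fin 4 → Mat4) (x y : Fin 4 → ℂ) (a b c d : ℂ) :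
    formMatrix M (a • x + b • y) (c • x + d • y) = formMatrix M x y * tensorSquare a b c d := by
  ext i j
  fin_cases j <;>
    simp [formMatrix, tensorSquare, Matrix.mul_apply, Fin.sum_univ_four, mulVec_add, mulVec_smul]
    <;> ring

/-- The adjugate is multiplicative, and passing to other vectors of the span multiplies `formMatrix`
on the right. In particular the condition depends only on the span of an independent pair. -/
theorem adjugate_formMatrix_ne_zero_of_mem_span {M : Fin 4 → Mat4} {x y u w : Fin 4 → ℂ}
    (hu : u ∈ Submodule.span ℂ {x, y}) (hw : w ∈ Submodule.span ℂ {x, y})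
    (h : (formMatrix M u w).adjugate ≠ 0) : (formMatrix M x y).adjugate ≠ 0 := by
  obtain ⟨a, b, rfl⟩ := Submodule.mem_span_pair.1 hu
  obtain ⟨c, d, rfl⟩ := Submodule.mem_span_pair.1 hw
  intro h0
  rw [formMatrix_change_of_basis, adjugate_mul_distrib, h0, mul_zero] at h
  exact h rfl

/-- Replacing row `r` by the `c`-th unit vector gives a matrix with determinant `N.adjugate c r`. If
this is nonzero, a kernel vector of `N` is determined by its `c`-th coordinate. -/
theorem exists_eq_smul_of_adjugate_ne_zero {N : Mat4} (hN : N.adjugate ≠ 0) {v v' : Fin 4 → ℂ}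
    (hv : N *ᵥ v = 0) (hv0 : v ≠ 0) (hv' : N *ᵥ v' = 0) : ∃ k : ℂ, v' = k • v := by
  obtain ⟨c, r, hcr⟩ : ∃ c r, N.adjugate c r ≠ 0 := by
    by_contra! h
    exact hN (Matrix.ext h)
  have key : ∀ z : Fin 4 → ℂ, N *ᵥ z = 0 → z c = 0 → z = 0 := by
    intro z hz hzc
    by_contra hne
    refine hcr ?_
    rw [adjugate_apply]
    refine exists_mulVec_eq_zero_iff.1 ⟨z, hne, ?_⟩
    ext i
    by_cases hi : i = r
    · subst hi
      simp [mulVec, hzc]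
    · have := congrFun hz i
      simpa [mulVec, updateRow_ne hi] using this
  have hvc : v c ≠ 0 := fun h => hv0 (key v hv h)
  refine ⟨v' c / v c, ?_⟩
  have := key (v' - (v' c / v c) • v) (by rw [mulVec_sub, mulVec_smul, hv, hv']; simp)
    (by simp [hvc])
  exact sub_eq_zero.1 this

theorem linearIndependent_pair_of_det_ne_zero {x y : Fin 4 → ℂ}
    (h : LinearIndependent ℂ ![x, y]) {a b c d : ℂ} (hd : a * d - b * c ≠ 0) :
    LinearIndependent ℂ ![a • x + b • y, c • x + d • y] := by
  rw [LinearIndependent.pair_iff] at h ⊢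
  intro s t hst
  obtain ⟨h1, h2⟩ := h (s * a + t * c) (s * b + t * d) (by rw [← hst]; module)
  constructor
  · refine (mul_eq_zero.1 (?_ : s * (a * d - b * c) = 0)).resolve_right hd
    linear_combination d * h1 - c * h2
  · refine (mul_eq_zero.1 (?_ : t * (a * d - b * c) = 0)).resolve_right hd
    linear_combination a * h2 - b * h1

theorem det_ne_zero_of_linearIndependent_pair {x y : Fin 4 → ℂ} {a b c d : ℂ}
    (h : LinearIndependent ℂ ![a • x + b • y, c • x + d • y]) : a * d - b * c ≠ 0 := by
  rw [LinearIndependent.pair_iff] at h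
  intro hd
  obtain ⟨h1, h2⟩ := h d (-b) (by
    have e : d • (a • x + b • y) + -b • (c • x + d • y) = (a * d - b * c) • x := by module
    rw [e, hd, zero_smul])
  obtain ⟨h3, h4⟩ := h c (-a) (by
    have e : c • (a • x + b • y) + -a • (c • x + d • y) = -(a * d - b * c) • y := by module
    rw [e, hd, neg_zero, zero_smul])
  obtain ⟨h5, h6⟩ := h 1 1 (by
    rw [h1, neg_eq_zero.1 h2, h3, neg_eq_zero.1 h4]; simp)
  exact one_ne_zero h5

theorem finrank_span_pair_eq_two {x y : Fin 4 → ℂ} (h : LinearIndependent ℂ ![x, y]) :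
    Module.finrank ℂ (Submodule.span ℂ {x, y}) = 2 := by
  have := finrank_span_eq_card h
  rwa [range_cons_cons_empty, Fintype.card_fin] at this

theorem span_pair_eq_of_linearIndependent {x y u w : Fin 4 → ℂ} (h : LinearIndependent ℂ ![x, y])
    (h' : LinearIndependent ℂ ![u, w])
    (hu : u ∈ Submodule.span ℂ {x, y}) (hw : w ∈ Submodule.span ℂ {x, y}) :
    Submodule.span ℂ {u, w} = Submodule.span ℂ {x, y} := by
  refine Submodule.eq_of_le_of_finrank_eq (Submodule.span_le.2 ?_) ?_
  · rintro z (rfl | rfl) <;> assumption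
  · rw [finrank_span_pair_eq_two h, finrank_span_pair_eq_two h']

/-- A bilinear form on `L` is determined by its values on the four pairs of basis vectors, so the
space of restrictions has the dimension of the row space of `formMatrix`. -/
theorem mem_determinantalLocus_iff {M : Fin 4 → Mat4} {L : Gr24} {x y : Fin 4 → ℂ}
    (hL : L.1 = Submodule.span ℂ {x, y}) :
    L ∈ determinantalLocus (spanOf M) ↔ (formMatrix M x y).det = 0 := by
  have hx : x ∈ L.1 := hL ▸ Submodule.subset_span (by simp)
  have hy : y ∈ L.1 := hL ▸ Submodule.subset_span (by simp)
  let ev : LinearMap.BilinForm ℂ L.1 →ₗ[ℂ] (Fin 4 → ℂ) :=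
    { toFun := fun B => ![B ⟨x, hx⟩ ⟨x, hx⟩, B ⟨x, hx⟩ ⟨y, hy⟩, B ⟨y, hy⟩ ⟨x, hx⟩,
        B ⟨y, hy⟩ ⟨y, hy⟩]
      map_add' := fun B C => by ext i; fin_cases i <;> simp
      map_smul' := fun a B => by ext i; fin_cases i <;> simp }
  have hev : Function.Injective ev := by
    refine (injective_iff_map_eq_zero ev).2 fun B hB => ?_
    have h0 : B ⟨x, hx⟩ ⟨x, hx⟩ = 0 := congrFun hB 0
    have h1 : B ⟨x, hx⟩ ⟨y, hy⟩ = 0 := congrFun hB 1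
    have h2 : B ⟨y, hy⟩ ⟨x, hx⟩ = 0 := congrFun hB 2
    have h3 : B ⟨y, hy⟩ ⟨y, hy⟩ = 0 := congrFun hB 3
    have hrep : ∀ z : L.1, ∃ a b : ℂ, z = a • ⟨x, hx⟩ + b • ⟨y, hy⟩ := by
      rintro ⟨z, hz⟩
      rw [hL] at hz
      obtain ⟨a, b, rfl⟩ := Submodule.mem_span_pair.1 hz
      exact ⟨a, b, rfl⟩
    ext z z'
    obtain ⟨a, b, rfl⟩ := hrep z
    obtain ⟨c, d, rfl⟩ := hrep z'
    simp only [map_add, map_smul, LinearMap.add_apply, LinearMap.smul_apply, h0, h1, h2, h3,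
      smul_zero, add_zero, LinearMap.zero_apply]
  have hrow : ∀ i, ev (restrictForm L.1 (M i)) = (formMatrix M x y) i := by
    intro i
    ext j
    fin_cases j <;> exact Matrix.toBilin'_apply' (M i) _ _
  have hspan : (((spanOf M).map (restrictForm L.1)).map ev) =
      Submodule.span ℂ (Set.range (formMatrix M x y).row) := by
    rw [spanOf, Submodule.map_span, Submodule.map_span, ← Set.range_comp, ← Set.range_comp]
    congr 2
    funext i
    exact hrow i
  have hfin : Module.finrank ℂ ((spanOf M).map (restrictForm L.1)) =
      (Set.range (formMatrix M x y).row).finrank ℂ := by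
    rw [Set.finrank, ← hspan]
    exact (Submodule.equivMapOfInjective ev hev _).finrank_eq
  change Module.finrank ℂ ((spanOf M).map (restrictForm L.1)) ≤ 3 ↔ _
  rw [hfin, ← not_iff_not, ← Ne, ← isUnit_iff_ne_zero, ← Matrix.isUnit_iff_isUnit_det,
    ← Matrix.linearIndependent_rows_iff_isUnit, linearIndependent_iff_card_le_finrank_span,
    Fintype.card_fin]
  omega

/-- The equations of `Z` and the open conditions describing the locus where the map to `X` is
an isomorphism, for representatives `x, y, (s, t)`. -/
structure IsGoodPoint (M : Fin 4 → Mat4) (x y : Fin 4 → ℂ) (s t : ℂ) : Prop where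
  eqn : ∀ i, (s + t) * (x ⬝ᵥ M i *ᵥ y) + (s - t) * (y ⬝ᵥ M i *ᵥ x) = 0
  indep : LinearIndependent ℂ ![x, y]
  ne_zero : s ≠ 0
  adj : (formMatrix M x y).adjugate ≠ 0

/-- The vector consists of the coordinates of $(s+t)\,x\otimes y+(s-t)\,y\otimes x$ in the basis
$x\otimes x,\ x\otimes y,\ y\otimes x,\ y\otimes y$. -/
theorem formMatrix_mulVec_eq_zero_iff {M : Fin 4 → Mat4} {x y : Fin 4 → ℂ} {s t : ℂ} :
    formMatrix M x y *ᵥ ![0, s + t, s - t, 0] = 0 ↔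
      ∀ i, (s + t) * (x ⬝ᵥ M i *ᵥ y) + (s - t) * (y ⬝ᵥ M i *ᵥ x) = 0 := by
  rw [funext_iff]
  refine forall_congr' fun i => ?_
  rw [formMatrix_mulVec_apply]
  simp [mul_comm]

theorem symmetric_vector_ne_zero {s t : ℂ} (h : s ≠ 0 ∨ t ≠ 0) :
    (![0, s + t, s - t, 0] : Fin 4 → ℂ) ≠ 0 := by
  intro h0
  have h1 : s + t = 0 := congrFun h0 1
  have h2 : s - t = 0 := congrFun h0 2
  have h3 : s = 0 := by linear_combination (h1 + h2) / 2
  have h4 : t = 0 := by linear_combination (h1 - h2) / 2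
  simp_all

theorem det_formMatrix_eq_zero {M : Fin 4 → Mat4} {x y : Fin 4 → ℂ} {s t : ℂ}
    (h : ∀ i, (s + t) * (x ⬝ᵥ M i *ᵥ y) + (s - t) * (y ⬝ᵥ M i *ᵥ x) = 0) (hst : s ≠ 0 ∨ t ≠ 0) :
    (formMatrix M x y).det = 0 :=
  exists_mulVec_eq_zero_iff.1 ⟨_, symmetric_vector_ne_zero hst, formMatrix_mulVec_eq_zero_iff.2 h⟩

/-- The symmetric part becomes the product of the two new vectors, while the skew part is multiplied
by the determinant. -/
theorem tensorSquare_mulVec (a b c d s t : ℂ) :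
    tensorSquare a b c d *ᵥ ![0, s + t, s - t, 0] =
      ![2 * s * (a * c), s * (a * d + b * c) + t * (a * d - b * c),
        s * (a * d + b * c) - t * (a * d - b * c), 2 * s * (b * d)] := by
  ext i
  fin_cases i <;> simp [tensorSquare, mulVec, dotProduct, Fin.sum_univ_four] <;> ring

namespace IsGoodPoint

variable {M : Fin 4 → Mat4} {x y : Fin 4 → ℂ} {s t : ℂ}

theorem swap (h : IsGoodPoint M x y s t) : IsGoodPoint M y x s (-t) where
  eqn i := by linear_combination h.eqn i
  indep := LinearIndependent.pair_symm_iff.1 h.indep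
  ne_zero := h.ne_zero
  adj := adjugate_formMatrix_ne_zero_of_mem_span (Submodule.subset_span (by simp))
    (Submodule.subset_span (by simp)) h.adj

theorem smul (h : IsGoodPoint M x y s t) {a b c : ℂ} (ha : a ≠ 0) (hb : b ≠ 0) (hc : c ≠ 0) :
    IsGoodPoint M (a • x) (b • y) (c * s) (c * t) where
  eqn i := by
    simp only [mulVec_smul, dotProduct_smul, smul_dotProduct, smul_eq_mul]
    linear_combination a * b * c * h.eqn i
  indep := by
    simpa using linearIndependent_pair_of_det_ne_zero h.indep (a := a) (b := 0) (c := 0) (d := b)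
      (by simpa using ⟨ha, hb⟩)
  ne_zero := mul_ne_zero hc h.ne_zero
  adj := by
    refine adjugate_formMatrix_ne_zero_of_mem_span (Submodule.mem_span_pair.2 ⟨a⁻¹, 0, ?_⟩)
      (Submodule.mem_span_pair.2 ⟨0, b⁻¹, ?_⟩) h.adj
    · simp [smul_smul, ha]
    · simp [smul_smul, hb]

/-- A good point is determined, up to rescaling and the involution, by the span of `x` and `y`. -/
theorem unique (h : IsGoodPoint M x y s t) {x' y' : Fin 4 → ℂ} {s' t' : ℂ}
    (h' : IsGoodPoint M x' y' s' t')
    (hspan : Submodule.span ℂ {x', y'} = Submodule.span ℂ {x, y}) :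
    ∃ a b c : ℂ, a ≠ 0 ∧ b ≠ 0 ∧ c ≠ 0 ∧
      ((x' = a • x ∧ y' = b • y ∧ s' = c * s ∧ t' = c * t) ∨
        (x' = a • y ∧ y' = b • x ∧ s' = c * s ∧ t' = c * -t)) := by
  have hx : x' ∈ Submodule.span ℂ {x, y} := hspan ▸ Submodule.subset_span (by simp)
  have hy : y' ∈ Submodule.span ℂ {x, y} := hspan ▸ Submodule.subset_span (by simp)
  obtain ⟨a, b, rfl⟩ := Submodule.mem_span_pair.1 hx
  obtain ⟨c, d, rfl⟩ := Submodule.mem_span_pair.1 hy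
  have hdet := det_ne_zero_of_linearIndependent_pair h'.indep
  have hk := formMatrix_mulVec_eq_zero_iff.2 h'.eqn
  rw [formMatrix_change_of_basis, ← mulVec_mulVec, tensorSquare_mulVec] at hk
  obtain ⟨k, hk⟩ := exists_eq_smul_of_adjugate_ne_zero h.adj
    (formMatrix_mulVec_eq_zero_iff.2 h.eqn) (symmetric_vector_ne_zero (Or.inl h.ne_zero)) hk
  have h0 : 2 * s' * (a * c) = k * 0 := congrFun hk 0
  have h1 : s' * (a * d + b * c) + t' * (a * d - b * c) = k * (s + t) := congrFun hk 1
  have h2 : s' * (a * d + b * c) - t' * (a * d - b * c) = k * (s - t) := congrFun hk 2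
  have h3 : 2 * s' * (b * d) = k * 0 := congrFun hk 3
  have hs' := h'.ne_zero
  -- The kernel is a line, so both symmetric parts have the same two factors. The outer coordinates
  -- vanish, which leaves only a diagonal or an antidiagonal change of basis.
  have hac : a * c = 0 := by simpa [hs'] using h0
  have hbd : b * d = 0 := by simpa [hs'] using h3
  have e1 : s' * (a * d + b * c) = k * s := by linear_combination (h1 + h2) / 2
  have e2 : t' * (a * d - b * c) = k * t := by linear_combination (h1 - h2) / 2
  by_cases ha : a = 0
  · subst ha
    have hb : b ≠ 0 := by rintro rfl; simp at hdet
    have hc : c ≠ 0 := by rintro rfl; simp at hdet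
    have hd : d = 0 := by simpa [hb] using hbd
    subst hd
    have e1' : s' = k / (b * c) * s := by field_simp; linear_combination e1
    have hk0 : k / (b * c) ≠ 0 := by rintro h; rw [h, zero_mul] at e1'; exact hs' e1'
    refine ⟨b, c, k / (b * c), hb, hc, hk0, Or.inr ⟨by simp, by simp, e1', ?_⟩⟩
    field_simp
    linear_combination -e2
  · have hc : c = 0 := by simpa [ha] using hac
    subst hc
    have hd : d ≠ 0 := by rintro rfl; simp at hdet
    have hb : b = 0 := by simpa [hd] using hbd
    subst hb
    have e1' : s' = k / (a * d) * s := by field_simp; linear_combination e1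
    have hk0 : k / (a * d) ≠ 0 := by rintro h; rw [h, zero_mul] at e1'; exact hs' e1'
    refine ⟨a, d, k / (a * d), ha, hd, hk0, Or.inl ⟨by simp, by simp, e1', ?_⟩⟩
    field_simp
    linear_combination e2

end IsGoodPoint

/-- A nondegenerate tensor in the square of a two-dimensional space is of the form
`s (x ⊗ y + y ⊗ x) + t (x ⊗ y - y ⊗ x)`. -/
theorem exists_tensorSquare_mulVec_eq (v : Fin 4 → ℂ) (hv : (v 1 + v 2) ^ 2 ≠ 4 * v 0 * v 3) :
    ∃ a b c d s t : ℂ, a * d - b * c ≠ 0 ∧ s ≠ 0 ∧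
      tensorSquare a b c d *ᵥ ![0, s + t, s - t, 0] = v := by
  simp only [tensorSquare_mulVec]
  by_cases h0 : v 0 = 0
  · have hs : v 1 + v 2 ≠ 0 := by
      intro h
      rw [h, h0] at hv
      simp at hv
    -- With `v 0 = 0` the quadratic form `v 0 X² + (v 1 + v 2) XY + v 3 Y²` has the factor `Y`, and
    -- the other factor can be read off.
    refine ⟨1, v 3 / (v 1 + v 2), 0, 1, (v 1 + v 2) / 2, (v 1 - v 2) / 2, by simp,
      by simpa using hs,
      ?_⟩
    ext i
    fin_cases i <;> simp [h0] <;> field_simp <;> ring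
  · obtain ⟨r, hr⟩ := IsAlgClosed.exists_pow_nat_eq ((v 1 + v 2) ^ 2 - 4 * v 0 * v 3)
      (n := 2) two_pos
    have hr0 : r ≠ 0 := by
      rintro rfl
      exact hv (by linear_combination -hr)
    -- With `a = c = 1`, the numbers `b` and `d` are the roots of `v 0 z² - (v 1 + v 2) z + v 3`.
    -- Then `d - b = r / v 0`, and `t` is fixed by `t (d - b) = (v 1 - v 2) / 2`.
    refine ⟨1, (v 1 + v 2 - r) / (2 * v 0), 1, (v 1 + v 2 + r) / (2 * v 0), v 0 / 2,
      v 0 * (v 1 - v 2) / (2 * r), ?_, by simpa using h0, ?_⟩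
    · have : 1 * ((v 1 + v 2 + r) / (2 * v 0)) - (v 1 + v 2 - r) / (2 * v 0) * 1 = r / v 0 := by
        field_simp; ring
      rw [this]
      exact div_ne_zero hr0 h0
    · ext i
      fin_cases i <;> simp <;> field_simp
      · ring
      · ring
      · linear_combination -hr

theorem exists_isGoodPoint {M : Fin 4 → Mat4} {u w : Fin 4 → ℂ} (h : LinearIndependent ℂ ![u, w])
    {v : Fin 4 → ℂ} (hv : (v 1 + v 2) ^ 2 ≠ 4 * v 0 * v 3) (hM : formMatrix M u w *ᵥ v = 0)
    (hadj : (formMatrix M u w).adjugate ≠ 0) :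
    ∃ x y s t, IsGoodPoint M x y s t ∧ Submodule.span ℂ {x, y} = Submodule.span ℂ {u, w} := by
  obtain ⟨a, b, c, d, s, t, hd, hs, rfl⟩ := exists_tensorSquare_mulVec_eq v hv
  have hind := linearIndependent_pair_of_det_ne_zero h hd
  have hspan : Submodule.span ℂ {a • u + b • w, c • u + d • w} = Submodule.span ℂ {u, w} :=
    span_pair_eq_of_linearIndependent h hind (Submodule.mem_span_pair.2 ⟨a, b, rfl⟩)
      (Submodule.mem_span_pair.2 ⟨c, d, rfl⟩)
  refine ⟨a • u + b • w, c • u + d • w, s, t, ⟨?_, hind, hs, ?_⟩, hspan⟩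
  · rw [← formMatrix_mulVec_eq_zero_iff, formMatrix_change_of_basis, ← mulVec_mulVec, hM]
  · refine adjugate_formMatrix_ne_zero_of_mem_span ?_ ?_ hadj <;> rw [hspan] <;>
      exact Submodule.subset_span (by simp)

end BilinearForms

/-! ### Density of the good points for generic matrices -/

section Genericity

open MvPolynomial

/-- The entries of a tuple of matrices. -/
def entries (M : Fin 4 → Mat4) : Fin 4 × Fin 4 × Fin 4 → ℂ := fun k => M k.1 k.2.1 k.2.2

/-- Density in the fibres, over a generic tuple of matrices, of the incidence variety
`∑ (M i)ₐᵦ Tₐᵦ(v) = 0`, away from the zeros of `T`. -/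
theorem exists_generic_dense_incidence {N : Type} [Finite N]
    (T : Fin 4 → Fin 4 → MvPolynomial N ℂ) (δ : MvPolynomial ((Fin 4 × Fin 4 × Fin 4) ⊕ N) ℂ)
    (hδ : ∃ (M : Fin 4 → Mat4) (v : N → ℂ), (∀ i, ∑ a, ∑ b, M i a b * eval v (T a b) = 0) ∧
      (∀ a b, eval v (T a b) ≠ 0) ∧ eval (Sum.elim (entries M) v) δ ≠ 0) :
    ∃ P : MvPolynomial (Fin 4 × Fin 4 × Fin 4) ℂ, P ≠ 0 ∧
      ∀ M : Fin 4 → Mat4, eval (entries M) P ≠ 0 →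
        ∀ v : N → ℂ, (∀ i, ∑ a, ∑ b, M i a b * eval v (T a b) = 0) →
          (∃ a b, eval v (T a b) ≠ 0) → ∀ F : MvPolynomial N ℂ, eval v F ≠ 0 →
            ∃ v' : N → ℂ, (∀ i, ∑ a, ∑ b, M i a b * eval v' (T a b) = 0) ∧ eval v' F ≠ 0 ∧
              eval (Sum.elim (entries M) v') δ ≠ 0 := by
  classical
  let T' : Fin 4 → Fin 4 → MvPolynomial ((Fin 4 × Fin 4 × Fin 4) ⊕ N) ℂ :=
    fun a b => rename Sum.inr (T a b)
  -- On the chart where the entry `(a₀, b₀)` of `T` is nonzero, each equation is solved for the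
  -- entry `(a₀, b₀)` of its matrix. With denominators cleared, `(Y, v) ↦ (f, v)` lands in the
  -- incidence variety and covers this chart, since `Y = M / T a₀ b₀` maps to `M`.
  let f : Fin 4 → Fin 4 → Fin 4 × Fin 4 × Fin 4 →
      MvPolynomial ((Fin 4 × Fin 4 × Fin 4) ⊕ N) ℂ := fun a₀ b₀ k =>
    X (Sum.inl k) * T' a₀ b₀ -
      if k.2 = (a₀, b₀) then ∑ a, ∑ b, X (Sum.inl (k.1, a, b)) * T' a b else 0
  have hT' : ∀ Y v a b, eval (Sum.elim Y v) (T' a b) = eval v (T a b) := fun Y v a b => by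
    simp only [T', eval_rename, Sum.elim_comp_inr]
  have hf : ∀ a₀ b₀ (Y : Fin 4 × Fin 4 × Fin 4 → ℂ) (v : N → ℂ) k,
      eval (Sum.elim Y v) (f a₀ b₀ k) = Y k * eval v (T a₀ b₀) -
        if k.2 = (a₀, b₀) then ∑ a, ∑ b, Y (k.1, a, b) * eval v (T a b) else 0 := by
    intro a₀ b₀ Y v k
    simp only [f, map_sub, map_mul, eval_X, Sum.elim_inl, hT']
    split_ifs <;> simp [map_sum, hT']
  have hfsum : ∀ a₀ b₀ (Y : Fin 4 × Fin 4 × Fin 4 → ℂ) (v : N → ℂ) i,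
      ∑ a, ∑ b, eval (Sum.elim Y v) (f a₀ b₀ (i, a, b)) * eval v (T a b) = 0 := by
    intro a₀ b₀ Y v i
    simp only [hf, sub_mul, Finset.sum_sub_distrib, ite_mul, zero_mul, Prod.mk.injEq, ite_and]
    simp only [Finset.sum_ite_eq', Finset.mem_univ, if_true, Finset.sum_ite_irrel,
      Finset.sum_const_zero]
    rw [sub_eq_zero, Finset.sum_mul]
    refine Finset.sum_congr rfl fun a _ => ?_
    rw [Finset.sum_mul]
    exact Finset.sum_congr rfl fun b _ => by ring
  have hfM : ∀ a₀ b₀ (M : Fin 4 → Mat4) (v : N → ℂ), eval v (T a₀ b₀) ≠ 0 →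
      (∀ i, ∑ a, ∑ b, M i a b * eval v (T a b) = 0) →
      (fun k => eval (Sum.elim (fun k => entries M k / eval v (T a₀ b₀)) v) (f a₀ b₀ k)) =
        entries M := by
    intro a₀ b₀ M v h hM
    funext k
    have h0 : ∑ a, ∑ b, entries M (k.1, a, b) / eval v (T a₀ b₀) * eval v (T a b) = 0 := by
      have := congrArg (· / eval v (T a₀ b₀)) (hM k.1)
      simp only [zero_div, Finset.sum_div] at this
      rw [← this]
      exact Finset.sum_congr rfl fun a _ => Finset.sum_congr rfl fun b _ => by
        simp only [entries]; ring
    rw [hf, h0, ite_self, sub_zero, div_mul_cancel₀ _ h]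
  let δ' : Fin 4 → Fin 4 → MvPolynomial ((Fin 4 × Fin 4 × Fin 4) ⊕ N) ℂ := fun a₀ b₀ =>
    aeval (Sum.elim (f a₀ b₀) (fun j => X (Sum.inr j))) δ
  have hδ' : ∀ a₀ b₀ Y v, eval (Sum.elim Y v) (δ' a₀ b₀) =
      eval (Sum.elim (fun k => eval (Sum.elim Y v) (f a₀ b₀ k)) v) δ := by
    intro a₀ b₀ Y v
    rw [eval_aeval]
    congr 1
    congr 1
    ext (k | j) <;> simp
  -- All entries of `T` are nonzero at the sample, so the same sample serves every chart.
  have hδ0 : ∀ a₀ b₀, δ' a₀ b₀ ≠ 0 := by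
    intro a₀ b₀ h0
    obtain ⟨M, v, hM, hT, hne⟩ := hδ
    have := hδ' a₀ b₀ (fun k => entries M k / eval v (T a₀ b₀)) v
    rw [hfM a₀ b₀ M v (hT _ _) hM, h0, map_zero] at this
    exact hne this.symm
  choose P hP0 hP using fun a₀ b₀ => exists_generic_dense_in_fibre (f a₀ b₀)
    (T' a₀ b₀ * δ' a₀ b₀) (mul_ne_zero (fun h => by
      obtain ⟨M, v, hM, hT, hne⟩ := hδ
      have := hT' 0 v a₀ b₀
      rw [h, map_zero] at this
      exact hT a₀ b₀ this.symm) (hδ0 a₀ b₀))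
  refine ⟨∏ a, ∏ b, P a b, Finset.prod_ne_zero_iff.2 fun a _ => Finset.prod_ne_zero_iff.2
    fun b _ => hP0 a b, ?_⟩
  rintro M hM v hv ⟨a₀, b₀, hab⟩ F hF
  have hMab : eval (entries M) (P a₀ b₀) ≠ 0 := by
    rw [map_prod] at hM
    have := Finset.prod_ne_zero_iff.1 hM a₀ (Finset.mem_univ _)
    rw [map_prod] at this
    exact Finset.prod_ne_zero_iff.1 this b₀ (Finset.mem_univ _)
  have hM' := hfM a₀ b₀ M v hab hv
  obtain ⟨b, hb, hbF, hbδ⟩ := hP a₀ b₀ (Sum.elim (fun k => entries M k / eval v (T a₀ b₀)) v)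
    (by rw [hM']; exact hMab) (rename Sum.inr F) (by rwa [eval_rename, Sum.elim_comp_inr])
  obtain ⟨Y, v', rfl⟩ : ∃ Y v', b = Sum.elim Y v' :=
    ⟨b ∘ Sum.inl, b ∘ Sum.inr, (Sum.elim_comp_inl_inr b).symm⟩
  have hb' : ∀ k, eval (Sum.elim Y v') (f a₀ b₀ k) = entries M k := fun k =>
    (hb k).trans (congrFun hM' k)
  rw [eval_rename, Sum.elim_comp_inr] at hbF
  refine ⟨v', fun i => ?_, hbF, ?_⟩
  · have := hfsum a₀ b₀ Y v' i
    simp only [hb'] at this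
    exact this
  · rw [map_mul] at hbδ
    have := right_ne_zero_of_mul hbδ
    rw [hδ', funext hb'] at this
    exact this

section

open Matrix

/-- The matrix `formMatrix` for indeterminate matrices and polynomial vectors. -/
noncomputable def polyFormMatrix {N : Type}
    (x y : Fin 4 → MvPolynomial ((Fin 4 × Fin 4 × Fin 4) ⊕ N) ℂ) :
    Matrix (Fin 4) (Fin 4) (MvPolynomial ((Fin 4 × Fin 4 × Fin 4) ⊕ N) ℂ) :=
  let A : Fin 4 → Matrix (Fin 4) (Fin 4) (MvPolynomial ((Fin 4 × Fin 4 × Fin 4) ⊕ N) ℂ) :=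
    fun i => of fun a b => X (Sum.inl (i, a, b))
  of fun i => ![x ⬝ᵥ A i *ᵥ x, x ⬝ᵥ A i *ᵥ y, y ⬝ᵥ A i *ᵥ x, y ⬝ᵥ A i *ᵥ y]

theorem eval_adjugate_polyFormMatrix {N : Type} (M : Fin 4 → Mat4) (v : N → ℂ)
    (x y : Fin 4 → MvPolynomial ((Fin 4 × Fin 4 × Fin 4) ⊕ N) ℂ) (c r : Fin 4) :
    eval (Sum.elim (entries M) v) ((polyFormMatrix x y).adjugate c r) =
      (formMatrix M (fun a => eval (Sum.elim (entries M) v) (x a))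
        (fun a => eval (Sum.elim (entries M) v) (y a))).adjugate c r := by
  have h : (eval (Sum.elim (entries M) v)).mapMatrix (polyFormMatrix x y) =
      formMatrix M (fun a => eval (Sum.elim (entries M) v) (x a))
        (fun a => eval (Sum.elim (entries M) v) (y a)) := by
    ext i j
    fin_cases j <;> simp [polyFormMatrix, formMatrix, dotProduct, mulVec, entries]
  rw [← h, ← RingHom.map_adjugate]
  rfl

/-- A tuple of matrices and two vectors in general position. -/
noncomputable def sampleMatrices : Fin 4 → Mat4 :=
  ![0, !![4, -2, 0, 0; -2, 1, 0, 0; 0, 0, 0, 0; 0, 0, 0, 0],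
    !![1, -1, 0, 0; -1, 1, 0, 0; 0, 0, 0, 0; 0, 0, 0, 0],
    !![0, 1, 0, 0; -1, 0, 0, 0; 0, 0, 0, 0; 0, 0, 0, 0]]

/-- With $\alpha=2e_0^*-e_1^*$ and $\beta=e_1^*-e_0^*$, dual to the two vectors, the samples are
$0$, $\alpha\otimes\alpha$, $\beta\otimes\beta$ and $\alpha\otimes\beta-\beta\otimes\alpha$. The
last equality uses $\alpha\wedge\beta=e_0^*\wedge e_1^*$. The kernel is spanned by $(0,1,1,0)$. -/
theorem formMatrix_sampleMatrices :
    formMatrix sampleMatrices ![1, 1, 1, 1] ![1, 2, 3, 4] =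
      !![0, 0, 0, 0; 1, 0, 0, 0; 0, 0, 0, 1; 0, 1, -1, 0] := by
  ext i j
  fin_cases i <;> fin_cases j <;>
    simp [formMatrix, sampleMatrices, dotProduct, mulVec, Fin.sum_univ_four] <;> norm_num

theorem adjugate_formMatrix_sampleMatrices :
    (formMatrix sampleMatrices ![1, 1, 1, 1] ![1, 2, 3, 4]).adjugate 1 0 ≠ 0 := by
  rw [formMatrix_sampleMatrices, adjugate_apply]
  simp [det_succ_row_zero, Fin.sum_univ_succ, updateRow_apply, Fin.succAbove, Pi.single_apply]

theorem linearIndependent_of_minor_ne_zero {x y : Fin 4 → ℂ} {i j : Fin 4}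
    (h : x i * y j - x j * y i ≠ 0) : LinearIndependent ℂ ![x, y] := by
  rw [LinearIndependent.pair_iff]
  intro a b hab
  have hi : a * x i + b * y i = 0 := congrFun hab i
  have hj : a * x j + b * y j = 0 := congrFun hab j
  constructor
  · refine (mul_eq_zero.1 (?_ : a * (x i * y j - x j * y i) = 0)).resolve_right h
    linear_combination y j * hi - y i * hj
  · refine (mul_eq_zero.1 (?_ : b * (x i * y j - x j * y i) = 0)).resolve_right h
    linear_combination x i * hj - x j * hi

/-- For generic matrices, the good points are dense among the solutions of the equations of `Z`
outside the excess component. -/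
theorem exists_generic_dense_isGoodPoint :
    ∃ P : MvPolynomial (Fin 4 × Fin 4 × Fin 4) ℂ, P ≠ 0 ∧
      ∀ M : Fin 4 → Mat4, eval (entries M) P ≠ 0 → ∀ (x y : Fin 4 → ℂ) (q : Fin 2 → ℂ),
        (∀ i, (q 0 + q 1) * (x ⬝ᵥ M i *ᵥ y) + (q 0 - q 1) * (y ⬝ᵥ M i *ᵥ x) = 0) →
        (∃ a b, (q 0 + q 1) * (x a * y b) + (q 0 - q 1) * (y a * x b) ≠ 0) →
        ∀ F : MvPolynomial (Fin 4 ⊕ Fin 4 ⊕ Fin 2) ℂ,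
          eval (Sum.elim x (Sum.elim y q)) F ≠ 0 →
          ∃ (x' y' : Fin 4 → ℂ) (q' : Fin 2 → ℂ), IsGoodPoint M x' y' (q' 0) (q' 1) ∧
            eval (Sum.elim x' (Sum.elim y' q')) F ≠ 0 := by
  let N := Fin 4 ⊕ Fin 4 ⊕ Fin 2
  let T : Fin 4 → Fin 4 → MvPolynomial N ℂ := fun a b =>
    (X (Sum.inr (Sum.inr 0)) + X (Sum.inr (Sum.inr 1))) *
        (X (Sum.inl a) * X (Sum.inr (Sum.inl b))) +
      (X (Sum.inr (Sum.inr 0)) - X (Sum.inr (Sum.inr 1))) *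
        (X (Sum.inr (Sum.inl a)) * X (Sum.inl b))
  let x₀ : Fin 4 → MvPolynomial ((Fin 4 × Fin 4 × Fin 4) ⊕ N) ℂ := fun a => X (Sum.inr (Sum.inl a))
  let y₀ : Fin 4 → MvPolynomial ((Fin 4 × Fin 4 × Fin 4) ⊕ N) ℂ := fun a =>
    X (Sum.inr (Sum.inr (Sum.inl a)))
  -- The three factors ensure `s ≠ 0`, the independence of `x, y` and a nonzero adjugate.
  let δ : MvPolynomial ((Fin 4 × Fin 4 × Fin 4) ⊕ N) ℂ :=
    X (Sum.inr (Sum.inr (Sum.inr 0))) * (x₀ 0 * y₀ 1 - x₀ 1 * y₀ 0) *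
      (polyFormMatrix x₀ y₀).adjugate 1 0
  have hT : ∀ (x y : Fin 4 → ℂ) (q : Fin 2 → ℂ) a b, eval (Sum.elim x (Sum.elim y q)) (T a b) =
      (q 0 + q 1) * (x a * y b) + (q 0 - q 1) * (y a * x b) := by
    intro x y q a b
    simp [T]
  have hsum : ∀ (M : Mat4) (x y : Fin 4 → ℂ) (q : Fin 2 → ℂ),
      ∑ a, ∑ b, M a b * eval (Sum.elim x (Sum.elim y q)) (T a b) =
        (q 0 + q 1) * (x ⬝ᵥ M *ᵥ y) + (q 0 - q 1) * (y ⬝ᵥ M *ᵥ x) := by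
    intro M x y q
    simp only [hT, dotProduct, mulVec, Finset.mul_sum, ← Finset.sum_add_distrib]
    exact Finset.sum_congr rfl fun a _ => Finset.sum_congr rfl fun b _ => by ring
  have hδ : ∀ (M : Fin 4 → Mat4) (x y : Fin 4 → ℂ) (q : Fin 2 → ℂ),
      eval (Sum.elim (entries M) (Sum.elim x (Sum.elim y q))) δ =
        q 0 * (x 0 * y 1 - x 1 * y 0) * (formMatrix M x y).adjugate 1 0 := by
    intro M x y q
    simp only [δ, map_mul, map_sub, eval_adjugate_polyFormMatrix, x₀, y₀, eval_X, Sum.elim_inr,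
      Sum.elim_inl]
  obtain ⟨P, hP0, hP⟩ := exists_generic_dense_incidence T δ
    ⟨sampleMatrices, Sum.elim ![1, 1, 1, 1] (Sum.elim ![1, 2, 3, 4] ![1, 0]), fun i => by
      rw [hsum]
      refine formMatrix_mulVec_eq_zero_iff.1 ?_ i
      rw [formMatrix_sampleMatrices]
      ext j
      fin_cases j <;> simp [mulVec, dotProduct, Fin.sum_univ_four], fun a b => by
      rw [hT]
      fin_cases a <;> fin_cases b <;> simp <;> norm_num, by
      rw [hδ]
      refine mul_ne_zero ?_ adjugate_formMatrix_sampleMatrices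
      simp
      norm_num⟩
  refine ⟨P, hP0, fun M hM x y q hq hab F hF => ?_⟩
  obtain ⟨v, hv, hvF, hvδ⟩ := hP M hM (Sum.elim x (Sum.elim y q)) (fun i => by rw [hsum, hq])
    (by simpa only [hT] using hab) F hF
  obtain ⟨x', y', q', rfl⟩ : ∃ x' y' q', v = Sum.elim x' (Sum.elim y' q') :=
    ⟨v ∘ Sum.inl, v ∘ Sum.inr ∘ Sum.inl, v ∘ Sum.inr ∘ Sum.inr, by ext (i | i | i) <;> rfl⟩
  rw [hδ] at hvδ
  refine ⟨x', y', q', ⟨fun i => by rw [← hsum, hv],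
    linearIndependent_of_minor_ne_zero (right_ne_zero_of_mul (left_ne_zero_of_mul hvδ)),
    left_ne_zero_of_mul (left_ne_zero_of_mul hvδ), fun h => ?_⟩, hvF⟩
  rw [h] at hvδ
  simp at hvδ

/-- The four tensor products of `u, w` are independent: contracting the first slot and then the
second gives back the coefficients. -/
theorem exists_tensor_ne_zero {u w v : Fin 4 → ℂ} (h : LinearIndependent ℂ ![u, w]) (hv : v ≠ 0) :
    ∃ a b, v 0 * (u a * u b) + v 1 * (u a * w b) + v 2 * (w a * u b) + v 3 * (w a * w b) ≠ 0 := by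
  by_contra! h0
  rw [LinearIndependent.pair_iff] at h
  have h1 : ∀ b, v 0 * u b + v 1 * w b = 0 ∧ v 2 * u b + v 3 * w b = 0 := fun b =>
    h _ _ (by
      ext a
      simp only [Pi.add_apply, Pi.smul_apply, smul_eq_mul, Pi.zero_apply]
      linear_combination h0 a b)
  obtain ⟨h2, h3⟩ := h (v 0) (v 1) (funext fun b => (h1 b).1)
  obtain ⟨h4, h5⟩ := h (v 2) (v 3) (funext fun b => (h1 b).2)
  refine hv (funext fun i => ?_)
  fin_cases i <;> assumption

/-- For generic matrices, the subspaces spanned by good points are dense in `X`. -/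
theorem exists_generic_dense_determinantalLocus :
    ∃ P : MvPolynomial (Fin 4 × Fin 4 × Fin 4) ℂ, P ≠ 0 ∧
      ∀ M : Fin 4 → Mat4, eval (entries M) P ≠ 0 → ∀ u w : Fin 4 → ℂ,
        LinearIndependent ℂ ![u, w] → (formMatrix M u w).det = 0 →
        ∀ F : MvPolynomial (Fin 4 ⊕ Fin 4) ℂ, eval (Sum.elim u w) F ≠ 0 →
          ∃ u' w' : Fin 4 → ℂ, LinearIndependent ℂ ![u', w'] ∧
            (∃ x y s t, IsGoodPoint M x y s t ∧
              Submodule.span ℂ {x, y} = Submodule.span ℂ {u', w'}) ∧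
            eval (Sum.elim u' w') F ≠ 0 := by
  -- The determinant is not linear in the matrices. With a kernel vector `v` as a third block of
  -- variables, the condition becomes linear and the incidence argument applies.
  let N := (Fin 4 ⊕ Fin 4) ⊕ Fin 4
  let T : Fin 4 → Fin 4 → MvPolynomial N ℂ := fun a b =>
    X (Sum.inr 0) * (X (Sum.inl (Sum.inl a)) * X (Sum.inl (Sum.inl b))) +
    X (Sum.inr 1) * (X (Sum.inl (Sum.inl a)) * X (Sum.inl (Sum.inr b))) +
    X (Sum.inr 2) * (X (Sum.inl (Sum.inr a)) * X (Sum.inl (Sum.inl b))) +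
    X (Sum.inr 3) * (X (Sum.inl (Sum.inr a)) * X (Sum.inl (Sum.inr b)))
  let x₀ : Fin 4 → MvPolynomial ((Fin 4 × Fin 4 × Fin 4) ⊕ N) ℂ := fun a =>
    X (Sum.inr (Sum.inl (Sum.inl a)))
  let y₀ : Fin 4 → MvPolynomial ((Fin 4 × Fin 4 × Fin 4) ⊕ N) ℂ := fun a =>
    X (Sum.inr (Sum.inl (Sum.inr a)))
  let v₀ : Fin 4 → MvPolynomial ((Fin 4 × Fin 4 × Fin 4) ⊕ N) ℂ := fun a =>
    X (Sum.inr (Sum.inr a))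
  -- The first factor is the discriminant of the symmetric part of the kernel tensor; it must be
  -- nonzero for that part to split into two independent vectors.
  let δ : MvPolynomial ((Fin 4 × Fin 4 × Fin 4) ⊕ N) ℂ :=
    ((v₀ 1 + v₀ 2) ^ 2 - C 4 * v₀ 0 * v₀ 3) * (x₀ 0 * y₀ 1 - x₀ 1 * y₀ 0) *
      (polyFormMatrix x₀ y₀).adjugate 1 0
  have hT : ∀ (u w v : Fin 4 → ℂ) a b, eval (Sum.elim (Sum.elim u w) v) (T a b) =
      v 0 * (u a * u b) + v 1 * (u a * w b) + v 2 * (w a * u b) + v 3 * (w a * w b) := by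
    intro u w v a b
    simp [T]
  have hsum : ∀ (M : Fin 4 → Mat4) (u w v : Fin 4 → ℂ) (i : Fin 4),
      ∑ a, ∑ b, M i a b * eval (Sum.elim (Sum.elim u w) v) (T a b) =
        (formMatrix M u w *ᵥ v) i := by
    intro M u w v i
    rw [formMatrix_mulVec_apply]
    simp only [hT, dotProduct, mulVec, Finset.mul_sum, Finset.sum_mul, ← Finset.sum_add_distrib]
    exact Finset.sum_congr rfl fun a _ => Finset.sum_congr rfl fun b _ => by ring
  have hδ : ∀ (M : Fin 4 → Mat4) (u w v : Fin 4 → ℂ),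
      eval (Sum.elim (entries M) (Sum.elim (Sum.elim u w) v)) δ =
        ((v 1 + v 2) ^ 2 - 4 * v 0 * v 3) * (u 0 * w 1 - u 1 * w 0) *
          (formMatrix M u w).adjugate 1 0 := by
    intro M u w v
    simp only [δ, map_mul, map_sub, map_add, map_pow, eval_adjugate_polyFormMatrix, x₀, y₀, v₀,
      eval_X, eval_C, Sum.elim_inr, Sum.elim_inl]
  obtain ⟨P, hP0, hP⟩ := exists_generic_dense_incidence T δ
    ⟨sampleMatrices, Sum.elim (Sum.elim ![1, 1, 1, 1] ![1, 2, 3, 4]) ![0, 1, 1, 0], fun i => by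
      rw [hsum, formMatrix_sampleMatrices]
      fin_cases i <;> simp [mulVec, dotProduct, Fin.sum_univ_four], fun a b => by
      rw [hT]
      fin_cases a <;> fin_cases b <;> simp <;> norm_num, by
      rw [hδ]
      refine mul_ne_zero ?_ adjugate_formMatrix_sampleMatrices
      simp
      norm_num⟩
  refine ⟨P, hP0, fun M hM u w huw hdet F hF => ?_⟩
  obtain ⟨v, hv0, hv⟩ := exists_mulVec_eq_zero_iff.2 hdet
  obtain ⟨z, hz, hzF, hzδ⟩ := hP M hM (Sum.elim (Sum.elim u w) v)
    (fun i => by rw [hsum, hv, Pi.zero_apply]) (by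
      simpa only [hT] using exists_tensor_ne_zero huw hv0) (rename Sum.inl F)
    (by rwa [eval_rename, Sum.elim_comp_inl])
  obtain ⟨u', w', v', rfl⟩ : ∃ u' w' v', z = Sum.elim (Sum.elim u' w') v' :=
    ⟨z ∘ Sum.inl ∘ Sum.inl, z ∘ Sum.inl ∘ Sum.inr, z ∘ Sum.inr, by ext ((i | i) | i) <;> rfl⟩
  rw [hδ] at hzδ
  rw [eval_rename, Sum.elim_comp_inl] at hzF
  have hind := linearIndependent_of_minor_ne_zero
    (right_ne_zero_of_mul (left_ne_zero_of_mul hzδ))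
  refine ⟨u', w', hind, exists_isGoodPoint hind
    (sub_ne_zero.1 (left_ne_zero_of_mul (left_ne_zero_of_mul hzδ))) (v := v')
    (funext fun i => by rw [← hsum, hz, Pi.zero_apply]) fun h => ?_, hzF⟩
  rw [h] at hzδ
  simp at hzδ

end

end Genericity

/-! ### Plücker coordinates and change of basis -/

section Pluecker

open Matrix

/-- The `2 × 2` minors of a pair of vectors. -/
def minors (x y : Fin 4 → ℂ) : Fin 4 × Fin 4 → ℂ := fun k => x k.1 * y k.2 - x k.2 * y k.1

theorem exists_minors_ne_zero {x y : Fin 4 → ℂ} (h : LinearIndependent ℂ ![x, y]) :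
    ∃ i j, minors x y (i, j) ≠ 0 := by
  by_contra! h0
  rw [LinearIndependent.pair_iff] at h
  have h1 : ∀ i, x i = 0 := fun i => neg_eq_zero.1 (h (y i) (-x i) (by
    ext j
    have := h0 i j
    simp only [minors] at this
    simp only [Pi.add_apply, Pi.smul_apply, smul_eq_mul, Pi.zero_apply]
    linear_combination -this)).2
  exact one_ne_zero (h 1 0 (by ext i; simp [h1 i])).1

theorem minors_change_of_basis (x y : Fin 4 → ℂ) (a b c d : ℂ) :
    minors (a • x + b • y) (c • x + d • y) = (a * d - b * c) • minors x y := by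
  ext k
  simp only [minors, Pi.add_apply, Pi.smul_apply, smul_eq_mul]
  ring

/-- The Plücker vector is computed in a chosen basis, and another basis multiplies it by the
determinant of the transition matrix. -/
theorem exists_pluecker_eq_smul {L : Gr24} {x y : Fin 4 → ℂ}
    (hL : L.1 = Submodule.span ℂ {x, y}) : ∃ c : ℂ, c ≠ 0 ∧ L.pluecker = c • minors x y := by
  let b := Module.finBasisOfFinrankEq ℂ L.1 L.2
  have h0 : ((b 0 : L.1) : Fin 4 → ℂ) ∈ Submodule.span ℂ {x, y} := hL ▸ (b 0).2
  have h1 : ((b 1 : L.1) : Fin 4 → ℂ) ∈ Submodule.span ℂ {x, y} := hL ▸ (b 1).2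
  obtain ⟨a, a', ha⟩ := Submodule.mem_span_pair.1 h0
  obtain ⟨c, c', hc⟩ := Submodule.mem_span_pair.1 h1
  have hb : LinearIndependent ℂ ![((b 0 : L.1) : Fin 4 → ℂ), ((b 1 : L.1) : Fin 4 → ℂ)] := by
    have := b.linearIndependent.map' L.1.subtype (Submodule.ker_subtype _)
    have e : L.1.subtype ∘ b = ![((b 0 : L.1) : Fin 4 → ℂ), ((b 1 : L.1) : Fin 4 → ℂ)] := by
      funext i
      fin_cases i <;> rfl
    rwa [e] at this
  have hp : L.pluecker = minors ((b 0 : L.1) : Fin 4 → ℂ) ((b 1 : L.1) : Fin 4 → ℂ) := by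
    ext k
    simp only [Gr24.pluecker, minors]
    ring
  rw [← ha, ← hc] at hb hp
  exact ⟨_, det_ne_zero_of_linearIndependent_pair hb, by rw [hp, minors_change_of_basis]⟩

end Pluecker

/-! ### Matrix operations inside a ring of functions -/

section Subalgebra

open Matrix

variable {P : Type} {R : Subalgebra ℂ (P → ℂ)}

theorem dotProduct_mulVec_mem {U W : P → Fin 4 → ℂ} (hU : ∀ a, (fun p => U p a) ∈ R)
    (hW : ∀ a, (fun p => W p a) ∈ R) (A : Mat4) : (fun p => U p ⬝ᵥ A *ᵥ W p) ∈ R := by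
  have : (fun p => U p ⬝ᵥ A *ᵥ W p) =
      ∑ a, (fun p => U p a) * ∑ b, algebraMap ℂ (P → ℂ) (A a b) * (fun p => W p b) := by
    ext p
    simp [dotProduct, mulVec]
  rw [this]
  exact R.sum_mem fun a _ => R.mul_mem (hU a) (R.sum_mem fun b _ =>
    R.mul_mem (R.algebraMap_mem _) (hW b))

/-- The adjugate can be formed over the ring `R` itself, and evaluation at a point is a ring
homomorphism. -/
theorem adjugate_mem {N : P → Mat4} (hN : ∀ i j, (fun p => N p i j) ∈ R) (a b : Fin 4) :
    (fun p => (N p).adjugate a b) ∈ R := by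
  let N' : Matrix (Fin 4) (Fin 4) R := of fun i j => ⟨_, hN i j⟩
  have : (fun p => (N p).adjugate a b) = (N'.adjugate a b : P → ℂ) := by
    ext p
    have h := RingHom.map_adjugate ((Pi.evalRingHom (fun _ : P => ℂ) p).comp R.val.toRingHom) N'
    exact (congrFun (congrFun h a) b).symm
  rw [this]
  exact (N'.adjugate a b).2

end Subalgebra

/-! ### Regularity of the inverse map near the span of a good point -/

section LocalInverse

open Matrix MvPolynomial

/-- The homogeneous coordinates `x, y, (s, t)`, rescaled to invariant functions. -/
noncomputable def scaledCoords (i j k l : Fin 4) (x y : Fin 4 → ℂ) (s t : ℂ) :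
    Fin 4 ⊕ Fin 4 ⊕ Fin 2 → ℂ :=
  Sum.elim ((y l / minors x y (i, j)) • x)
    (Sum.elim ((x k / minors x y (i, j)) • y) (s⁻¹ • ![s, t]))

variable {M : Fin 4 → Mat4}

/-- The ring of functions on `X` which are regular at a point. -/
noncomputable abbrev locusRegularAt (L : determinantalLocus (spanOf M)) :
    Subalgebra ℂ (determinantalLocus (spanOf M) → ℂ) :=
  regularAt (fun L : determinantalLocus (spanOf M) => Gr24.pluecker L) (fun _ => (1 : ℕ)) L

/-- Near the line spanned by a good point, the kernel tensor of the restricted forms is given by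
regular functions. -/
theorem exists_regular_kernel_tensor {L₀ : determinantalLocus (spanOf M)} {x₀ y₀ : Fin 4 → ℂ}
    {s₀ t₀ : ℂ} (h₀ : IsGoodPoint M x₀ y₀ s₀ t₀) (hL₀ : L₀.1.1 = Submodule.span ℂ {x₀, y₀}) :
    ∃ T : Fin 4 → Fin 4 → determinantalLocus (spanOf M) → ℂ,
      (∀ a b, T a b ∈ locusRegularAt L₀) ∧
      ∃ O, IsOpen[(determinantalStructure (spanOf M)).top] O ∧ L₀ ∈ O ∧
        ∀ L ∈ O, (∃ x y s t, IsGoodPoint M x y s t ∧ L.1.1 = Submodule.span ℂ {x, y}) ∧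
          ∀ x y s t, IsGoodPoint M x y s t → L.1.1 = Submodule.span ℂ {x, y} →
            ∃ κ : ℂ, κ ≠ 0 ∧ ∀ a b,
              (s + t) * (x a * y b) + (s - t) * (y a * x b) = κ * T a b L := by
  obtain ⟨i, j, hij⟩ := exists_minors_ne_zero h₀.indep
  let X' := determinantalLocus (spanOf M)
  let pl : X' → Fin 4 × Fin 4 → ℂ := fun L => Gr24.pluecker L
  -- Rows `i` and `j` of the skew matrix of Plücker coordinates lie in `L`. Divided by the `(i, j)`
  -- coordinate they form a basis whose entries are regular functions.
  let u : X' → Fin 4 → ℂ := fun L a => pl L (i, a) / pl L (i, j)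
  let w : X' → Fin 4 → ℂ := fun L a => pl L (j, a) / pl L (i, j)
  have hpl0 : pl L₀ (i, j) ≠ 0 := by
    obtain ⟨c, hc, h⟩ := exists_pluecker_eq_smul hL₀
    rw [show pl L₀ = c • minors x₀ y₀ from h]
    exact mul_ne_zero hc hij
  have hX : ∀ k : Fin 4 × Fin 4, (X k : MvPolynomial (Fin 4 × Fin 4) ℂ).IsWeightedHomogeneous
      (fun _ => (1 : ℕ)) 1 := fun k => isWeightedHomogeneous_X _ _ _
  have hreg : ∀ k : Fin 4 × Fin 4, (fun L : X' => pl L k / pl L (i, j)) ∈ locusRegularAt L₀ := by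
    intro k
    have := div_mem_regularAt (c := fun L : X' => Gr24.pluecker L) (p := L₀) (hX k) (hX (i, j))
      (by rw [eval_X]; exact hpl0)
    simpa only [eval_X] using this
  have huR : ∀ a, (fun L => u L a) ∈ locusRegularAt L₀ := fun a => hreg (i, a)
  have hwR : ∀ a, (fun L => w L a) ∈ locusRegularAt L₀ := fun a => hreg (j, a)
  have hspan : ∀ L : X', pl L (i, j) ≠ 0 → LinearIndependent ℂ ![u L, w L] ∧
      L.1.1 = Submodule.span ℂ {u L, w L} := by
    intro L hL
    have hfin : Module.finrank ℂ L.1.1 = 2 := L.1.2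
    let b := Module.finBasisOfFinrankEq ℂ L.1.1 L.1.2
    have hpb : ∀ k, pl L k = minors (b 0 : L.1.1).1 (b 1 : L.1.1).1 k := by
      intro k
      simp only [pl, Gr24.pluecker, minors, b]
    have hind : LinearIndependent ℂ ![u L, w L] := by
      refine linearIndependent_of_minor_ne_zero (i := i) (j := j) ?_
      have e1 : u L i = 0 := by simp [u, hpb, minors]
      have e2 : u L j = 1 := div_self hL
      have e3 : w L i = -1 := by
        have : pl L (j, i) = -pl L (i, j) := by simp only [hpb, minors]; ring
        simp only [w, this, neg_div, div_self hL]
      rw [e1, e2, e3]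
      norm_num
    have hmem : ∀ a : Fin 4, (fun c => pl L (a, c) / pl L (i, j)) ∈ L.1.1 := by
      intro a
      have : (fun c => pl L (a, c) / pl L (i, j)) =
          ((b 0 : L.1.1).1 a / pl L (i, j)) • (b 1 : L.1.1).1 -
            ((b 1 : L.1.1).1 a / pl L (i, j)) • (b 0 : L.1.1).1 := by
        ext c
        simp only [hpb, minors, Pi.sub_apply, Pi.smul_apply, smul_eq_mul]
        ring
      rw [this]
      exact L.1.1.sub_mem (L.1.1.smul_mem _ (b 1).2) (L.1.1.smul_mem _ (b 0).2)
    refine ⟨hind, (Submodule.eq_of_le_of_finrank_eq (Submodule.span_le.2 ?_) ?_).symm⟩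
    · rintro z (rfl | rfl)
      exacts [hmem i, hmem j]
    · rw [finrank_span_pair_eq_two hind, hfin]
  let N : X' → Mat4 := fun L => formMatrix M (u L) (w L)
  have hN : ∀ a b, (fun L => N L a b) ∈ locusRegularAt L₀ := by
    intro a b
    fin_cases b
    · exact dotProduct_mulVec_mem huR huR _
    · exact dotProduct_mulVec_mem huR hwR _
    · exact dotProduct_mulVec_mem hwR huR _
    · exact dotProduct_mulVec_mem hwR hwR _
  have hadj0 : (N L₀).adjugate ≠ 0 := by
    have hs := (hspan L₀ hpl0).2
    rw [hL₀] at hs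
    refine adjugate_formMatrix_ne_zero_of_mem_span ?_ ?_ h₀.adj <;> rw [← hs] <;>
      exact Submodule.subset_span (by simp)
  obtain ⟨c, r, hcr⟩ : ∃ c r, (N L₀).adjugate c r ≠ 0 := by
    by_contra! h
    exact hadj0 (Matrix.ext h)
  -- The determinant of `N L` vanishes on `X`, so each column of the adjugate is a kernel vector. It
  -- has regular entries, and column `r` is nonzero near `L₀`.
  let v : X' → Fin 4 → ℂ := fun L a => (N L).adjugate a r
  have hvR : ∀ a, (fun L => v L a) ∈ locusRegularAt L₀ := fun a => adjugate_mem hN a r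
  have hNv : ∀ L : X', pl L (i, j) ≠ 0 → N L *ᵥ v L = 0 := by
    intro L hL
    have hdet : (N L).det = 0 := (mem_determinantalLocus_iff (hspan L hL).2).1 L.2
    ext a
    have := congrFun (congrFun (mul_adjugate (N L)) a) r
    rw [hdet, zero_smul] at this
    exact this
  have key : ∀ L : X', pl L (i, j) ≠ 0 → v L c ≠ 0 → ∀ x y s t, IsGoodPoint M x y s t →
      L.1.1 = Submodule.span ℂ {x, y} → ∃ κ : ℂ, κ ≠ 0 ∧
        (∀ a b, (s + t) * (x a * y b) + (s - t) * (y a * x b) =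
          κ * (v L 0 * (u L a * u L b) + v L 1 * (u L a * w L b) + v L 2 * (w L a * u L b) +
            v L 3 * (w L a * w L b))) ∧ (v L 1 + v L 2) ^ 2 ≠ 4 * v L 0 * v L 3 := by
    intro L hL hvc x y s t h hxy
    obtain ⟨hind, hs⟩ := hspan L hL
    have hx : x ∈ Submodule.span ℂ {u L, w L} :=
      hs ▸ hxy ▸ Submodule.subset_span (by simp)
    have hy : y ∈ Submodule.span ℂ {u L, w L} :=
      hs ▸ hxy ▸ Submodule.subset_span (by simp)
    obtain ⟨a, b, hab⟩ := Submodule.mem_span_pair.1 hx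
    obtain ⟨a', b', hab'⟩ := Submodule.mem_span_pair.1 hy
    have hk := formMatrix_mulVec_eq_zero_iff.2 h.eqn
    rw [← hab, ← hab', formMatrix_change_of_basis, ← mulVec_mulVec, tensorSquare_mulVec] at hk
    obtain ⟨κ, hκ⟩ := exists_eq_smul_of_adjugate_ne_zero (N := N L)
      (fun h0 => hvc (congrFun (congrFun h0 c) r)) (hNv L hL)
      (fun h0 => hvc (congrFun h0 c)) hk
    have e0 : 2 * s * (a * a') = κ * v L 0 := congrFun hκ 0
    have e1 : s * (a * b' + b * a') + t * (a * b' - b * a') = κ * v L 1 := congrFun hκ 1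
    have e2 : s * (a * b' + b * a') - t * (a * b' - b * a') = κ * v L 2 := congrFun hκ 2
    have e3 : 2 * s * (b * b') = κ * v L 3 := congrFun hκ 3
    have hdet : a * b' - b * a' ≠ 0 := by
      have := h.indep
      rw [← hab, ← hab'] at this
      exact det_ne_zero_of_linearIndependent_pair this
    -- Comparison of discriminants: at a good point the right side is nonzero, which forces both `κ
    -- ≠ 0` and a nondegenerate symmetric part.
    have hd : κ ^ 2 * ((v L 1 + v L 2) ^ 2 - 4 * v L 0 * v L 3) =
        4 * s ^ 2 * (a * b' - b * a') ^ 2 := by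
      linear_combination -(κ * (v L 1 + v L 2) + (2 * s * (a * b' + b * a'))) * (e1 + e2) +
        4 * κ * v L 3 * e0 + 4 * (2 * s * (a * a')) * e3
    have hd0 : κ ^ 2 * ((v L 1 + v L 2) ^ 2 - 4 * v L 0 * v L 3) ≠ 0 := by
      rw [hd]
      exact mul_ne_zero (mul_ne_zero (by norm_num) (pow_ne_zero _ h.ne_zero)) (pow_ne_zero _ hdet)
    refine ⟨κ, fun h0 => hd0 (by rw [h0]; ring), fun p q => ?_,
      fun h0 => hd0 (by rw [h0]; ring)⟩
    rw [← hab, ← hab']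
    simp only [Pi.add_apply, Pi.smul_apply, smul_eq_mul]
    linear_combination (u L p * u L q) * e0 + (u L p * w L q) * e1 + (w L p * u L q) * e2 +
      (w L p * w L q) * e3
  have hdiscR : (fun L => (v L 1 + v L 2) ^ 2 - 4 * v L 0 * v L 3) ∈ locusRegularAt L₀ :=
    Subalgebra.sub_mem _ (Subalgebra.pow_mem _ (Subalgebra.add_mem _ (hvR 1) (hvR 2)) 2)
      (Subalgebra.mul_mem _ (Subalgebra.mul_mem _ (Subalgebra.algebraMap_mem _ (4 : ℂ)) (hvR 0))
        (hvR 3))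
  obtain ⟨O₁, hO₁, hL₁, hv₁⟩ := exists_isOpen_ne_zero_of_mem_regularAt (hvR c) hcr
  obtain ⟨κ₀, hκ₀, hT₀, hdisc₀⟩ := key L₀ hpl0 hcr x₀ y₀ s₀ t₀ h₀ hL₀
  obtain ⟨O₂, hO₂, hL₂, hv₂⟩ := exists_isOpen_ne_zero_of_mem_regularAt hdiscR
    (sub_ne_zero.2 hdisc₀)
  have hO₃ := isOpen_eval_ne_zero (fun L : X' => Gr24.pluecker L) (fun _ => (1 : ℕ)) (hX (i, j))
  refine ⟨fun a b L => v L 0 * (u L a * u L b) + v L 1 * (u L a * w L b) +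
    v L 2 * (w L a * u L b) + v L 3 * (w L a * w L b), fun a b => ?_,
    O₁ ∩ O₂ ∩ {L | eval (Gr24.pluecker L) (X (i, j)) ≠ 0}, ?_, ⟨⟨hL₁, hL₂⟩, ?_⟩, ?_⟩
  · exact Subalgebra.add_mem _ (Subalgebra.add_mem _ (Subalgebra.add_mem _
      (Subalgebra.mul_mem _ (hvR 0) (Subalgebra.mul_mem _ (huR a) (huR b)))
      (Subalgebra.mul_mem _ (hvR 1) (Subalgebra.mul_mem _ (huR a) (hwR b))))
      (Subalgebra.mul_mem _ (hvR 2) (Subalgebra.mul_mem _ (hwR a) (huR b))))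
      (Subalgebra.mul_mem _ (hvR 3) (Subalgebra.mul_mem _ (hwR a) (hwR b)))
  · let _ := (determinantalStructure (spanOf M)).top
    exact (IsOpen.inter hO₁ hO₂).inter hO₃
  · rw [Set.mem_ofPred_eq, eval_X]
    exact hpl0
  · rintro L ⟨⟨h1, h2⟩, h3⟩
    rw [Set.mem_ofPred_eq, eval_X] at h3
    obtain ⟨hind, hs⟩ := hspan L h3
    constructor
    · obtain ⟨x, y, s, t, h, hxy⟩ := exists_isGoodPoint hind (sub_ne_zero.1 (hv₂ L h2))
        (hNv L h3) (fun h0 => hv₁ L h1 (congrFun (congrFun h0 c) r))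
      exact ⟨x, y, s, t, h, hs.trans hxy.symm⟩
    · intro x y s t h hxy
      obtain ⟨κ, hκ, hT, -⟩ := key L h3 (hv₁ L h1) x y s t h hxy
      exact ⟨κ, hκ, hT⟩

theorem eval_smul_of_weight {F : MvPolynomial (Fin 4 ⊕ Fin 4 ⊕ Fin 2) ℂ} {d : ℕ × ℕ × ℕ}
    (hF : F.IsWeightedHomogeneous P3P3P1.weight d) (a b c : ℂ) (x y : Fin 4 → ℂ) (q : Fin 2 → ℂ) :
    eval (Sum.elim (a • x) (Sum.elim (b • y) (c • q))) F =
      a ^ d.1 * b ^ d.2.1 * c ^ d.2.2 * eval (Sum.elim x (Sum.elim y q)) F := by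
  let χ : Multiplicative (ℕ × ℕ × ℕ) →* ℂ :=
    { toFun := fun m => a ^ m.toAdd.1 * b ^ m.toAdd.2.1 * c ^ m.toAdd.2.2
      map_one' := by simp
      map_mul' := fun m n => by simp [pow_add]; ring }
  have := eval_mul_of_isWeightedHomogeneous χ (Sum.elim x (Sum.elim y q)) hF
  change _ = a ^ d.1 * b ^ d.2.1 * c ^ d.2.2 * _ at this
  rw [← this]
  congr 2
  ext (i | i | i) <;> simp [χ, P3P3P1.weight]

theorem eval_smul_of_degree {σ : Type} {F : MvPolynomial σ ℂ} {d : ℕ}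
    (hF : F.IsWeightedHomogeneous (fun _ => (1 : ℕ)) d) (c : ℂ) (v : σ → ℂ) :
    eval (c • v) F = c ^ d * eval v F := by
  let χ : Multiplicative ℕ →* ℂ :=
    { toFun := fun m => c ^ m.toAdd
      map_one' := by simp
      map_mul' := fun m n => by simp [pow_add] }
  have := eval_mul_of_isWeightedHomogeneous χ v hF
  change _ = c ^ d * _ at this
  rw [← this]
  congr 2
  ext i
  simp [χ]

/-- Near the line spanned by a good point, every polynomial in the rescaled coordinates is a
combination of `1` and one anti-invariant function, with coefficients regular on `X`. -/
theorem exists_eval_scaledCoords {L₀ : determinantalLocus (spanOf M)} {x₀ y₀ : Fin 4 → ℂ}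
    {s₀ t₀ : ℂ} (h₀ : IsGoodPoint M x₀ y₀ s₀ t₀) (hL₀ : L₀.1.1 = Submodule.span ℂ {x₀, y₀}) :
    ∃ (i j m n : Fin 4) (O : Set (determinantalLocus (spanOf M))),
      IsOpen[(determinantalStructure (spanOf M)).top] O ∧ L₀ ∈ O ∧
      (∀ L ∈ O, (∃ x y s t, IsGoodPoint M x y s t ∧ L.1.1 = Submodule.span ℂ {x, y}) ∧
        ∀ x y s t, IsGoodPoint M x y s t → L.1.1 = Submodule.span ℂ {x, y} →
          minors x y (i, j) ≠ 0 ∧ x m * y n + x n * y m ≠ 0) ∧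
      ∀ (k l : Fin 4) (F : MvPolynomial (Fin 4 ⊕ Fin 4 ⊕ Fin 2) ℂ),
        ∃ P ∈ locusRegularAt L₀, ∃ Q ∈ locusRegularAt L₀, ∀ L ∈ O, ∀ x y s t,
          IsGoodPoint M x y s t → L.1.1 = Submodule.span ℂ {x, y} →
          eval (scaledCoords i j k l x y s t) F =
            P L + Q L * ((x m * y n + x n * y m) / minors x y (i, j)) := by
  obtain ⟨T, hTR, O, hO, hLO, hT⟩ := exists_regular_kernel_tensor h₀ hL₀
  obtain ⟨i, j, hij⟩ := exists_minors_ne_zero h₀.indep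
  obtain ⟨m, n, hmn⟩ : ∃ m n, x₀ m * y₀ n + x₀ n * y₀ m ≠ 0 := by
    by_contra! h
    have hx : x₀ ≠ 0 := h₀.indep.ne_zero 0
    have hy : y₀ ≠ 0 := h₀.indep.ne_zero 1
    obtain ⟨k, hk⟩ := Function.ne_iff.1 hx
    obtain ⟨l, hl⟩ := Function.ne_iff.1 hy
    have h1 : y₀ k = 0 := by
      have := h k k
      have h2 : x₀ k * y₀ k = 0 := by linear_combination this / 2
      exact (mul_eq_zero.1 h2).resolve_left hk
    have h3 := h k l
    rw [h1, mul_zero, add_zero] at h3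
    exact mul_ne_zero hk hl h3
  let X' := determinantalLocus (spanOf M)
  let pl : X' → Fin 4 × Fin 4 → ℂ := fun L => Gr24.pluecker L
  have hX : ∀ k : Fin 4 × Fin 4, (X k : MvPolynomial (Fin 4 × Fin 4) ℂ).IsWeightedHomogeneous
      (fun _ => (1 : ℕ)) 1 := fun k => isWeightedHomogeneous_X _ _ _
  have hpl0 : pl L₀ (i, j) ≠ 0 := by
    obtain ⟨c, hc, h⟩ := exists_pluecker_eq_smul hL₀
    rw [show pl L₀ = c • minors x₀ y₀ from h]
    exact mul_ne_zero hc hij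
  have hreg : ∀ k : Fin 4 × Fin 4, (fun L : X' => pl L k / pl L (i, j)) ∈ locusRegularAt L₀ := by
    intro k
    have := div_mem_regularAt (c := fun L : X' => Gr24.pluecker L) (p := L₀) (hX k) (hX (i, j))
      (by rw [eval_X]; exact hpl0)
    simpa only [eval_X] using this
  let S : Fin 4 → Fin 4 → X' → ℂ := fun a b => T a b + T b a
  have hSR : ∀ a b, S a b ∈ locusRegularAt L₀ := fun a b => Subalgebra.add_mem _ (hTR a b) (hTR b a)
  have hS : ∀ (L : X') (x y : Fin 4 → ℂ) (s t κ : ℂ), (∀ a b,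
      (s + t) * (x a * y b) + (s - t) * (y a * x b) = κ * T a b L) →
      ∀ a b, 2 * s * (x a * y b + x b * y a) = κ * S a b L := by
    intro L x y s t κ h a b
    simp only [S, Pi.add_apply]
    linear_combination h a b + h b a
  -- A `2 × 2` minor of the symmetric part. For a product of two vectors it is minus the square of
  -- the minor of `x, y`, up to scale; this is what makes the square of the anti-invariant function
  -- regular.
  let D : X' → ℂ := S i i * S j j - S i j ^ 2
  have hDR : D ∈ locusRegularAt L₀ := Subalgebra.sub_mem _
    (Subalgebra.mul_mem _ (hSR i i) (hSR j j)) (Subalgebra.pow_mem _ (hSR i j) 2)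
  have hD : ∀ (L : X') (x y : Fin 4 → ℂ) (s t κ : ℂ), (∀ a b,
      (s + t) * (x a * y b) + (s - t) * (y a * x b) = κ * T a b L) →
      -(2 * s * minors x y (i, j)) ^ 2 = κ ^ 2 * D L := by
    intro L x y s t κ h
    have h1 := hS L x y s t κ h i i
    have h2 := hS L x y s t κ h j j
    have h3 := hS L x y s t κ h i j
    simp only [D, Pi.sub_apply, Pi.mul_apply, Pi.pow_apply, minors]
    linear_combination (2 * s * (x j * y j + x j * y j)) * h1 + κ * S i i L * h2 -
      (2 * s * (x i * y j + x j * y i) + κ * S i j L) * h3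
  obtain ⟨κ₀, hκ₀, hT₀⟩ := (hT L₀ hLO).2 x₀ y₀ s₀ t₀ h₀ hL₀
  have hS₀ : S m n L₀ ≠ 0 := by
    intro h
    have := hS L₀ x₀ y₀ s₀ t₀ κ₀ hT₀ m n
    rw [h, mul_zero] at this
    exact mul_ne_zero (mul_ne_zero two_ne_zero h₀.ne_zero) hmn this
  have hD₀ : D L₀ ≠ 0 := by
    intro h
    have := hD L₀ x₀ y₀ s₀ t₀ κ₀ hT₀
    rw [h, mul_zero, neg_eq_zero] at this
    exact pow_ne_zero 2 (mul_ne_zero (mul_ne_zero two_ne_zero h₀.ne_zero) hij) this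
  obtain ⟨O₁, hO₁, hL₁, hv₁⟩ := exists_isOpen_ne_zero_of_mem_regularAt (hSR m n) hS₀
  have hO₂ := isOpen_eval_ne_zero (fun L : X' => Gr24.pluecker L) (fun _ => (1 : ℕ)) (hX (i, j))
  have hΛ : ∀ L ∈ O ∩ O₁ ∩ {L : X' | eval (Gr24.pluecker L) (X (i, j)) ≠ 0}, ∀ x y s t,
      IsGoodPoint M x y s t → L.1.1 = Submodule.span ℂ {x, y} →
      minors x y (i, j) ≠ 0 ∧ x m * y n + x n * y m ≠ 0 := by
    rintro L ⟨⟨h1, h2⟩, h3⟩ x y s t h hxy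
    constructor
    · obtain ⟨c, hc, h⟩ := exists_pluecker_eq_smul hxy
      intro h0
      rw [Set.mem_ofPred_eq, eval_X, h, Pi.smul_apply, h0, smul_zero] at h3
      exact h3 rfl
    · obtain ⟨κ, hκ, hTL⟩ := (hT L h1).2 x y s t h hxy
      intro h0
      have := hS L x y s t κ hTL m n
      rw [h0, mul_zero] at this
      exact mul_ne_zero hκ (hv₁ L h2) this.symm
  refine ⟨i, j, m, n, O ∩ O₁ ∩ {L | eval (Gr24.pluecker L) (X (i, j)) ≠ 0}, ?_,
    ⟨⟨hLO, hL₁⟩, by rw [Set.mem_ofPred_eq, eval_X]; exact hpl0⟩,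
    fun L hL => ⟨(hT L hL.1.1).1, hΛ L hL⟩, fun k l F => ?_⟩
  · let _ := (determinantalStructure (spanOf M)).top
    exact (IsOpen.inter hO hO₁).inter hO₂
  let O' : Set X' := O ∩ O₁ ∩ {L | eval (Gr24.pluecker L) (X (i, j)) ≠ 0}
  -- This relation closes the expressions `P + Q E` under multiplication, as the induction on `F`
  -- requires.
  have hEsq : ∀ L ∈ O', ∀ x y s t, IsGoodPoint M x y s t → L.1.1 = Submodule.span ℂ {x, y} →
      ((x m * y n + x n * y m) / minors x y (i, j)) ^ 2 = -(S m n L ^ 2 * (D L)⁻¹) := by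
    intro L hL x y s t h hxy
    obtain ⟨κ, hκ, hTL⟩ := (hT L hL.1.1).2 x y s t h hxy
    obtain ⟨hm, hs⟩ := hΛ L hL x y s t h hxy
    have h1 := hS L x y s t κ hTL m n
    have h2 := hD L x y s t κ hTL
    have hs0 := h.ne_zero
    have hD0 : D L ≠ 0 := by
      intro h0
      rw [h0, mul_zero, neg_eq_zero] at h2
      exact pow_ne_zero 2 (mul_ne_zero (mul_ne_zero two_ne_zero hs0) hm) h2
    rw [div_pow, ← div_eq_mul_inv, ← neg_div, div_eq_div_iff (pow_ne_zero 2 hm) hD0]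
    refine mul_left_cancel₀ (pow_ne_zero 2 (mul_ne_zero hκ (mul_ne_zero two_ne_zero hs0))) ?_
    linear_combination (-(2 * s * (x m * y n + x n * y m)) ^ 2) * h2 -
      (2 * s * minors x y (i, j)) ^ 2 * (2 * s * (x m * y n + x n * y m) + κ * S m n L) * h1
  have hER : -(S m n ^ 2 * D⁻¹) ∈ locusRegularAt L₀ := Subalgebra.neg_mem _
    (Subalgebra.mul_mem _ (Subalgebra.pow_mem _ (hSR m n) 2) (inv_mem_regularAt hDR hD₀))
  have hSi : (S m n)⁻¹ ∈ locusRegularAt L₀ := inv_mem_regularAt (hSR m n) hS₀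
  have hhalf : ∀ f ∈ locusRegularAt L₀, (fun L => f L / 2) ∈ locusRegularAt L₀ := by
    intro f hf
    have := Subalgebra.mul_mem _ hf (Subalgebra.algebraMap_mem (locusRegularAt L₀) (2 : ℂ)⁻¹)
    convert this using 1
    ext L
    simp [div_eq_mul_inv]
  have hplr : ∀ L (x y : Fin 4 → ℂ), L.1.1 = Submodule.span ℂ {x, y} → minors x y (i, j) ≠ 0 →
      ∀ a b, pl L (a, b) / pl L (i, j) = minors x y (a, b) / minors x y (i, j) := by
    intro L x y hxy h a b
    obtain ⟨c, hc, h⟩ := exists_pluecker_eq_smul hxy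
    rw [show pl L = c • minors x y from h]
    simp only [Pi.smul_apply, smul_eq_mul]
    rw [mul_div_mul_left _ _ hc]
  have hratio : ∀ L ∈ O', ∀ x y s t, IsGoodPoint M x y s t → L.1.1 = Submodule.span ℂ {x, y} →
      ∀ a b, S a b L * (S m n L)⁻¹ = (x a * y b + x b * y a) / (x m * y n + x n * y m) := by
    intro L hL x y s t h hxy a b
    obtain ⟨κ, hκ, hTL⟩ := (hT L hL.1.1).2 x y s t h hxy
    obtain ⟨hm, hs⟩ := hΛ L hL x y s t h hxy
    have h1 := hS L x y s t κ hTL m n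
    have h2 := hS L x y s t κ hTL a b
    have hs0 := h.ne_zero
    rw [← div_eq_mul_inv, div_eq_div_iff (hv₁ L hL.1.2) hs]
    refine mul_left_cancel₀ (mul_ne_zero hκ (mul_ne_zero two_ne_zero hs0)) ?_
    linear_combination κ * S a b L * h1 - κ * S m n L * h2
  induction F using MvPolynomial.induction_on with
  | C r =>
    exact ⟨algebraMap ℂ _ r, Subalgebra.algebraMap_mem _ _, 0, Subalgebra.zero_mem _,
      fun L _ x y s t _ _ => by simp⟩
  | add F G hF hG =>
    obtain ⟨P, hP, Q, hQ, e⟩ := hF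
    obtain ⟨P', hP', Q', hQ', e'⟩ := hG
    refine ⟨P + P', Subalgebra.add_mem _ hP hP', Q + Q', Subalgebra.add_mem _ hQ hQ',
      fun L hL x y s t h hxy => ?_⟩
    rw [map_add, e L hL x y s t h hxy, e' L hL x y s t h hxy, Pi.add_apply, Pi.add_apply]
    ring
  | mul_X F z hF =>
    obtain ⟨P, hP, Q, hQ, e⟩ := hF
    obtain ⟨P', hP', Q', hQ', e'⟩ : ∃ P' ∈ locusRegularAt L₀, ∃ Q' ∈ locusRegularAt L₀,
        ∀ L ∈ O', ∀ x y s t, IsGoodPoint M x y s t → L.1.1 = Submodule.span ℂ {x, y} →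
          scaledCoords i j k l x y s t z =
            P' L + Q' L * ((x m * y n + x n * y m) / minors x y (i, j)) := by
      -- For `x` and `y`: a product `x a * y l` is half the sum of a symmetric expression and a
      -- minor. Divided by the `(i, j)` minor, the latter is a ratio of Plücker coordinates and the
      -- former a regular multiple of `E`.
      rcases z with a | a | a
      · refine ⟨_, hhalf _ (hreg (a, l)), _,
          hhalf _ (Subalgebra.mul_mem _ (hSR a l) hSi), fun L hL x y s t h hxy => ?_⟩
        obtain ⟨hm, hs⟩ := hΛ L hL x y s t h hxy
        simp only [Pi.mul_apply, Pi.inv_apply, hratio L hL x y s t h hxy, hplr L x y hxy hm]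
        simp only [scaledCoords, Sum.elim_inl, Pi.smul_apply, smul_eq_mul]
        field_simp
        simp only [minors]
        ring
      · refine ⟨_, hhalf _ (hreg (k, a)), _,
          hhalf _ (Subalgebra.mul_mem _ (hSR k a) hSi), fun L hL x y s t h hxy => ?_⟩
        obtain ⟨hm, hs⟩ := hΛ L hL x y s t h hxy
        simp only [Pi.mul_apply, Pi.inv_apply, hratio L hL x y s t h hxy, hplr L x y hxy hm]
        simp only [scaledCoords, Sum.elim_inl, Sum.elim_inr, Pi.smul_apply, smul_eq_mul]
        field_simp
        simp only [minors]
        ring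
      · fin_cases a
        · refine ⟨1, Subalgebra.one_mem _, 0, Subalgebra.zero_mem _, fun L hL x y s t h hxy => ?_⟩
          simp [scaledCoords, h.ne_zero]
        -- The skew part of `T` carries `t` times a minor and the symmetric part carries `s`, so `t
        -- / s` is a regular multiple of `E`.
        · refine ⟨0, Subalgebra.zero_mem _, (T i j - T j i) * (S m n)⁻¹,
            Subalgebra.mul_mem _ (Subalgebra.sub_mem _ (hTR i j) (hTR j i)) hSi,
            fun L hL x y s t h hxy => ?_⟩
          obtain ⟨hm, hs⟩ := hΛ L hL x y s t h hxy
          obtain ⟨κ, hκ, hTL⟩ := (hT L hL.1.1).2 x y s t h hxy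
          have h1 := hS L x y s t κ hTL m n
          have h2 : 2 * t * minors x y (i, j) = κ * (T i j L - T j i L) := by
            simp only [minors]
            linear_combination hTL i j - hTL j i
          have hs0 := h.ne_zero
          have hv := hv₁ L hL.1.2
          simp only [scaledCoords, Sum.elim_inr, Pi.smul_apply, smul_eq_mul, Pi.mul_apply,
            Pi.sub_apply, Pi.inv_apply, Pi.zero_apply, zero_add]
          change s⁻¹ * t = _
          have h3 : (T i j L - T j i L) * (S m n L)⁻¹ =
              t * minors x y (i, j) / (s * (x m * y n + x n * y m)) := by
            rw [← div_eq_mul_inv, div_eq_div_iff hv (mul_ne_zero hs0 hs)]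
            refine mul_left_cancel₀ (mul_ne_zero hκ two_ne_zero) ?_
            linear_combination κ * (T i j L - T j i L) * h1 - κ * S m n L * h2
          rw [h3]
          field_simp
    refine ⟨P * P' + Q * Q' * -(S m n ^ 2 * D⁻¹), Subalgebra.add_mem _ (Subalgebra.mul_mem _ hP hP')
      (Subalgebra.mul_mem _ (Subalgebra.mul_mem _ hQ hQ') hER), P * Q' + Q * P',
      Subalgebra.add_mem _ (Subalgebra.mul_mem _ hP hQ') (Subalgebra.mul_mem _ hQ hP'),
      fun L hL x y s t h hxy => ?_⟩
    have hE := hEsq L hL x y s t h hxy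
    rw [map_mul, eval_X, e L hL x y s t h hxy, e' L hL x y s t h hxy]
    simp only [Pi.add_apply, Pi.mul_apply, Pi.neg_apply, Pi.pow_apply, Pi.inv_apply]
    linear_combination Q L * Q' L * hE

theorem eval_scaledCoords {F : MvPolynomial (Fin 4 ⊕ Fin 4 ⊕ Fin 2) ℂ} {d : ℕ × ℕ × ℕ}
    (hF : F.IsWeightedHomogeneous P3P3P1.weight d) (i j k l : Fin 4) (x y : Fin 4 → ℂ) (s t : ℂ) :
    eval (scaledCoords i j k l x y s t) F =
      (y l / minors x y (i, j)) ^ d.1 * (x k / minors x y (i, j)) ^ d.2.1 * s⁻¹ ^ d.2.2 *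
        eval (Sum.elim x (Sum.elim y ![s, t])) F :=
  eval_smul_of_weight hF _ _ _ _ _ _

theorem eval_scaledCoords_ne_zero {F : MvPolynomial (Fin 4 ⊕ Fin 4 ⊕ Fin 2) ℂ} {d : ℕ × ℕ × ℕ}
    (hF : F.IsWeightedHomogeneous P3P3P1.weight d) {i j k l : Fin 4} {x y : Fin 4 → ℂ} {s t : ℂ}
    (hm : minors x y (i, j) ≠ 0) (hk : x k ≠ 0) (hl : y l ≠ 0) (hs : s ≠ 0)
    (h : eval (Sum.elim x (Sum.elim y ![s, t])) F ≠ 0) :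
    eval (scaledCoords i j k l x y s t) F ≠ 0 := by
  rw [eval_scaledCoords hF]
  exact mul_ne_zero (mul_ne_zero (mul_ne_zero (pow_ne_zero _ (div_ne_zero hl hm))
    (pow_ne_zero _ (div_ne_zero hk hm))) (pow_ne_zero _ (inv_ne_zero hs))) h

/-- The anti-invariant function changes sign under the involution. -/
theorem antiinvariant_swap (x y : Fin 4 → ℂ) (i j m n : Fin 4) :
    (y m * x n + y n * x m) / minors y x (i, j) =
      -((x m * y n + x n * y m) / minors x y (i, j)) := by
  have : minors y x (i, j) = -minors x y (i, j) := by simp only [minors]; ring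
  rw [this, div_neg]
  congr 2
  ring

/-- The map from good points to their lines is open. -/
theorem exists_isOpen_forall_exists_eval_ne_zero {L₀ : determinantalLocus (spanOf M)}
    {x₀ y₀ : Fin 4 → ℂ} {s₀ t₀ : ℂ} (h₀ : IsGoodPoint M x₀ y₀ s₀ t₀)
    (hL₀ : L₀.1.1 = Submodule.span ℂ {x₀, y₀}) {F : MvPolynomial (Fin 4 ⊕ Fin 4 ⊕ Fin 2) ℂ}
    {d : ℕ × ℕ × ℕ} (hF : F.IsWeightedHomogeneous P3P3P1.weight d)
    (hF₀ : eval (Sum.elim x₀ (Sum.elim y₀ ![s₀, t₀])) F ≠ 0) :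
    ∃ O, IsOpen[(determinantalStructure (spanOf M)).top] O ∧ L₀ ∈ O ∧ ∀ L ∈ O, ∃ x y s t,
      IsGoodPoint M x y s t ∧ L.1.1 = Submodule.span ℂ {x, y} ∧
        eval (Sum.elim x (Sum.elim y ![s, t])) F ≠ 0 := by
  obtain ⟨i, j, m, n, O, hO, hLO, hgood, hPQ⟩ := exists_eval_scaledCoords h₀ hL₀
  obtain ⟨k, hk⟩ := Function.ne_iff.1 (h₀.indep.ne_zero 0)
  obtain ⟨l, hl⟩ := Function.ne_iff.1 (h₀.indep.ne_zero 1)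
  obtain ⟨P, hP, Q, hQ, e⟩ := hPQ k l F
  have hne := eval_scaledCoords_ne_zero hF ((hgood L₀ hLO).2 x₀ y₀ s₀ t₀ h₀ hL₀).1 hk hl
    h₀.ne_zero hF₀
  rw [e L₀ hLO x₀ y₀ s₀ t₀ h₀ hL₀] at hne
  -- The two good points over `L` give the values `P + Q E` and `P - Q E`. With `E ≠ 0`, both vanish
  -- only if `P` and `Q` do.
  have key : ∀ L ∈ O, (P L ≠ 0 ∨ Q L ≠ 0) → ∃ x y s t, IsGoodPoint M x y s t ∧
      L.1.1 = Submodule.span ℂ {x, y} ∧ eval (Sum.elim x (Sum.elim y ![s, t])) F ≠ 0 := by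
    intro L hL hor
    obtain ⟨⟨x, y, s, t, h, hxy⟩, hL'⟩ := hgood L hL
    by_contra! hall
    have hyx : L.1.1 = Submodule.span ℂ {y, x} := by rw [hxy, Set.pair_comm]
    have e1 := e L hL x y s t h hxy
    have e2 := e L hL y x s (-t) h.swap hyx
    rw [eval_scaledCoords hF, hall x y s t h hxy, mul_zero] at e1
    rw [eval_scaledCoords hF, hall y x s (-t) h.swap hyx, mul_zero, antiinvariant_swap] at e2
    obtain ⟨hm, hs⟩ := hL' x y s t h hxy
    have h1 : P L = 0 := by linear_combination -(e1 + e2) / 2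
    have h2 : Q L * ((x m * y n + x n * y m) / minors x y (i, j)) = 0 := by
      linear_combination (e2 - e1) / 2
    have h3 : Q L = 0 := (mul_eq_zero.1 h2).resolve_right (div_ne_zero hs hm)
    exact hor.elim (fun h => h h1) (fun h => h h3)
  let _ := (determinantalStructure (spanOf M)).top
  by_cases hP0 : P L₀ = 0
  · have hQ0 : Q L₀ ≠ 0 := by
      intro h
      rw [hP0, h, zero_mul, add_zero] at hne
      exact hne rfl
    obtain ⟨O', hO', hL', hv⟩ := exists_isOpen_ne_zero_of_mem_regularAt hQ hQ0
    exact ⟨O ∩ O', IsOpen.inter hO hO', ⟨hLO, hL'⟩, fun L hL =>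
      key L hL.1 (Or.inr (hv L hL.2))⟩
  · obtain ⟨O', hO', hL', hv⟩ := exists_isOpen_ne_zero_of_mem_regularAt hP hP0
    exact ⟨O ∩ O', IsOpen.inter hO hO', ⟨hLO, hL'⟩, fun L hL =>
      key L hL.1 (Or.inl (hv L hL.2))⟩

/-- A function on `X` whose pull-back to the good points is a quotient of homogeneous polynomials
is regular. -/
theorem exists_mem_regularAt_eqOn {L₀ : determinantalLocus (spanOf M)}
    {x₀ y₀ : Fin 4 → ℂ} {s₀ t₀ : ℂ} (h₀ : IsGoodPoint M x₀ y₀ s₀ t₀)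
    (hL₀ : L₀.1.1 = Submodule.span ℂ {x₀, y₀}) {F G : MvPolynomial (Fin 4 ⊕ Fin 4 ⊕ Fin 2) ℂ}
    {d : ℕ × ℕ × ℕ} (hF : F.IsWeightedHomogeneous P3P3P1.weight d)
    (hG : G.IsWeightedHomogeneous P3P3P1.weight d)
    (hG₀ : eval (Sum.elim x₀ (Sum.elim y₀ ![s₀, t₀])) G ≠ 0)
    (A : Set (determinantalLocus (spanOf M))) (f : determinantalLocus (spanOf M) → ℂ)
    (hf : ∀ L ∈ A, ∀ x y s t, IsGoodPoint M x y s t → L.1.1 = Submodule.span ℂ {x, y} →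
      f L * eval (Sum.elim x (Sum.elim y ![s, t])) G = eval (Sum.elim x (Sum.elim y ![s, t])) F) :
    ∃ g ∈ locusRegularAt L₀, ∃ O, IsOpen[(determinantalStructure (spanOf M)).top] O ∧ L₀ ∈ O ∧
      ∀ L ∈ A ∩ O, f L = g L := by
  obtain ⟨i, j, m, n, O, hO, hLO, hgood, hPQ⟩ := exists_eval_scaledCoords h₀ hL₀
  obtain ⟨k, hk⟩ := Function.ne_iff.1 (h₀.indep.ne_zero 0)
  obtain ⟨l, hl⟩ := Function.ne_iff.1 (h₀.indep.ne_zero 1)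
  obtain ⟨P, hP, Q, hQ, e⟩ := hPQ k l F
  obtain ⟨P', hP', Q', hQ', e'⟩ := hPQ k l G
  have hne := eval_scaledCoords_ne_zero hG ((hgood L₀ hLO).2 x₀ y₀ s₀ t₀ h₀ hL₀).1 hk hl
    h₀.ne_zero hG₀
  rw [e' L₀ hLO x₀ y₀ s₀ t₀ h₀ hL₀] at hne
  have hsc : ∀ L ∈ A ∩ O, ∀ x y s t, IsGoodPoint M x y s t → L.1.1 = Submodule.span ℂ {x, y} →
      f L * (P' L + Q' L * ((x m * y n + x n * y m) / minors x y (i, j))) =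
        P L + Q L * ((x m * y n + x n * y m) / minors x y (i, j)) := by
    intro L hL x y s t h hxy
    rw [← e L hL.2 x y s t h hxy, ← e' L hL.2 x y s t h hxy, eval_scaledCoords hF,
      eval_scaledCoords hG, ← hf L hL.1 x y s t h hxy]
    ring
  -- `f` takes the same value at the two points of an orbit, so the even and odd parts in `E` can be
  -- compared separately. At `L₀` one of `P'`, `Q'` is nonzero and serves as denominator.
  have key : ∀ L ∈ A ∩ O, f L * P' L = P L ∧ f L * Q' L = Q L := by
    intro L hL
    obtain ⟨⟨x, y, s, t, h, hxy⟩, hL'⟩ := hgood L hL.2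
    obtain ⟨hm, hs⟩ := hL' x y s t h hxy
    have hyx : L.1.1 = Submodule.span ℂ {y, x} := by rw [hxy, Set.pair_comm]
    have e1 := hsc L hL x y s t h hxy
    have e2 := hsc L hL y x s (-t) h.swap hyx
    rw [antiinvariant_swap] at e2
    refine ⟨by linear_combination (e1 + e2) / 2, mul_right_cancel₀ (div_ne_zero hs hm) (?_ :
      f L * Q' L * ((x m * y n + x n * y m) / minors x y (i, j)) =
        Q L * ((x m * y n + x n * y m) / minors x y (i, j)))⟩
    linear_combination (e1 - e2) / 2
  let _ := (determinantalStructure (spanOf M)).top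
  by_cases hP0 : P' L₀ = 0
  · have hQ0 : Q' L₀ ≠ 0 := by
      intro h
      rw [hP0, h, zero_mul, add_zero] at hne
      exact hne rfl
    obtain ⟨O', hO', hL', hv⟩ := exists_isOpen_ne_zero_of_mem_regularAt hQ' hQ0
    refine ⟨Q * Q'⁻¹, Subalgebra.mul_mem _ hQ (inv_mem_regularAt hQ' hQ0), O ∩ O',
      IsOpen.inter hO hO', ⟨hLO, hL'⟩, fun L hL => ?_⟩
    rw [Pi.mul_apply, Pi.inv_apply, eq_mul_inv_iff_mul_eq₀ (hv L hL.2.2)]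
    exact (key L ⟨hL.1, hL.2.1⟩).2
  · obtain ⟨O', hO', hL', hv⟩ := exists_isOpen_ne_zero_of_mem_regularAt hP' hP0
    refine ⟨P * P'⁻¹, Subalgebra.mul_mem _ hP (inv_mem_regularAt hP' hP0), O ∩ O',
      IsOpen.inter hO hO', ⟨hLO, hL'⟩, fun L hL => ?_⟩
    rw [Pi.mul_apply, Pi.inv_apply, eq_mul_inv_iff_mul_eq₀ (hv L hL.2.2)]
    exact (key L ⟨hL.1, hL.2.1⟩).1

end LocalInverse

/-! ### Good points of `Z` and the subspaces they span -/

section Points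

open Matrix MvPolynomial

theorem vec_two_eta (q : Fin 2 → ℂ) : ![q 0, q 1] = q := by
  ext i
  fin_cases i <;> rfl

/-- The point of `ℙ³ × ℙ³ × ℙ¹` with given homogeneous coordinates. -/
noncomputable def P3P3P1.mk (x y : Fin 4 → ℂ) (q : Fin 2 → ℂ) (hx : x ≠ 0) (hy : y ≠ 0)
    (hq : q ≠ 0) : P3P3P1 :=
  (Projectivization.mk ℂ x hx, Projectivization.mk ℂ y hy, Projectivization.mk ℂ q hq)

theorem P3P3P1.exists_rep_mk {x y : Fin 4 → ℂ} {q : Fin 2 → ℂ} (hx : x ≠ 0) (hy : y ≠ 0)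
    (hq : q ≠ 0) : ∃ a b c : ℂ, a ≠ 0 ∧ b ≠ 0 ∧ c ≠ 0 ∧
      (P3P3P1.mk x y q hx hy hq).1.rep = a • x ∧ (P3P3P1.mk x y q hx hy hq).2.1.rep = b • y ∧
        (P3P3P1.mk x y q hx hy hq).2.2.rep = c • q := by
  obtain ⟨a, ha⟩ := Projectivization.exists_smul_eq_mk_rep ℂ x hx
  obtain ⟨b, hb⟩ := Projectivization.exists_smul_eq_mk_rep ℂ y hy
  obtain ⟨c, hc⟩ := Projectivization.exists_smul_eq_mk_rep ℂ q hq
  exact ⟨a, b, c, a.ne_zero, b.ne_zero, c.ne_zero, ha.symm, hb.symm, hc.symm⟩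

theorem P3P3P1.eval_coords_mk {x y : Fin 4 → ℂ} {q : Fin 2 → ℂ} (hx : x ≠ 0) (hy : y ≠ 0)
    (hq : q ≠ 0) (d : ℕ × ℕ × ℕ) : ∃ r : ℂ, r ≠ 0 ∧ ∀ F : MvPolynomial _ ℂ,
      F.IsWeightedHomogeneous P3P3P1.weight d →
        eval (P3P3P1.coords (P3P3P1.mk x y q hx hy hq)) F =
          r * eval (Sum.elim x (Sum.elim y q)) F := by
  obtain ⟨a, b, c, ha, hb, hc, h1, h2, h3⟩ := P3P3P1.exists_rep_mk hx hy hq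
  refine ⟨a ^ d.1 * b ^ d.2.1 * c ^ d.2.2, mul_ne_zero (mul_ne_zero (pow_ne_zero _ ha)
    (pow_ne_zero _ hb)) (pow_ne_zero _ hc), fun F hF => ?_⟩
  rw [P3P3P1.coords, h1, h2, h3, eval_smul_of_weight hF]

theorem Projectivization.eq_of_rep_eq_smul {V : Type} [AddCommGroup V] [Module ℂ V] {u v : ℙ ℂ V}
    {a : ℂ} (h : u.rep = a • v.rep) : u = v := by
  rw [← u.mk_rep, ← v.mk_rep, Projectivization.mk_eq_mk_iff']
  exact ⟨a, h.symm⟩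

theorem Projectivization.ne_iff_linearIndependent {u v : ℙ ℂ (Fin 4 → ℂ)} :
    u ≠ v ↔ LinearIndependent ℂ ![u.rep, v.rep] := by
  rw [← Projectivization.independent_pair_iff_ne, Projectivization.independent_iff]
  have : Projectivization.rep ∘ ![u, v] = ![u.rep, v.rep] := by
    funext i
    fin_cases i <;> rfl
  rw [this]

theorem Projectivization.submodule_sup_submodule (u v : ℙ ℂ (Fin 4 → ℂ)) :
    u.submodule ⊔ v.submodule = Submodule.span ℂ {u.rep, v.rep} := by
  rw [Projectivization.submodule_eq, Projectivization.submodule_eq, Submodule.span_insert]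

variable {M : Fin 4 → Mat4}

theorem mem_divisorIntersection_iff {p : P3P3P1} : p ∈ divisorIntersection M ↔
    ∀ i, (p.2.2.rep 0 + p.2.2.rep 1) * (p.1.rep ⬝ᵥ M i *ᵥ p.2.1.rep) +
      (p.2.2.rep 0 - p.2.2.rep 1) * (p.2.1.rep ⬝ᵥ M i *ᵥ p.1.rep) = 0 := by
  refine forall_congr' fun i => ?_
  rw [dotProduct_symPart_add_skewPart]
  simp

theorem isClosed_divisorIntersection : IsClosed[P3P3P1.structure.top] (divisorIntersection M) := by
  let xa : Fin 4 → MvPolynomial (Fin 4 ⊕ Fin 4 ⊕ Fin 2) ℂ := fun a => X (Sum.inl a)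
  let ya : Fin 4 → MvPolynomial (Fin 4 ⊕ Fin 4 ⊕ Fin 2) ℂ := fun a => X (Sum.inr (Sum.inl a))
  let qa : Fin 2 → MvPolynomial (Fin 4 ⊕ Fin 4 ⊕ Fin 2) ℂ := fun a => X (Sum.inr (Sum.inr a))
  let F : Fin 4 → MvPolynomial (Fin 4 ⊕ Fin 4 ⊕ Fin 2) ℂ := fun i =>
    ∑ a, ∑ b, C (M i a b) * ((qa 0 + qa 1) * (xa a * ya b) + (qa 0 - qa 1) * (xa b * ya a))
  have hx : ∀ a, (xa a).IsWeightedHomogeneous P3P3P1.weight (1, 0, 0) := fun a =>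
    isWeightedHomogeneous_X _ _ _
  have hy : ∀ a, (ya a).IsWeightedHomogeneous P3P3P1.weight (0, 1, 0) := fun a =>
    isWeightedHomogeneous_X _ _ _
  have hq : ∀ a, (qa a).IsWeightedHomogeneous P3P3P1.weight (0, 0, 1) := fun a =>
    isWeightedHomogeneous_X _ _ _
  have hF : ∀ i, (F i).IsWeightedHomogeneous P3P3P1.weight (1, 1, 1) := fun i =>
    IsWeightedHomogeneous.sum _ _ _ fun a _ => IsWeightedHomogeneous.sum _ _ _ fun b _ =>
      IsWeightedHomogeneous.C_mul (IsWeightedHomogeneous.add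
        (((hq 0).add (hq 1)).mul ((hx a).mul (hy b)))
        (((hq 0).sub (hq 1)).mul ((hx b).mul (hy a)))) _
  have hFe : ∀ i (p : P3P3P1), eval p.coords (F i) =
      (p.2.2.rep 0 + p.2.2.rep 1) * (p.1.rep ⬝ᵥ M i *ᵥ p.2.1.rep) +
        (p.2.2.rep 0 - p.2.2.rep 1) * (p.2.1.rep ⬝ᵥ M i *ᵥ p.1.rep) := by
    intro i p
    simp only [F, xa, ya, qa, map_sum, map_mul, map_add, map_sub, eval_C, eval_X, P3P3P1.coords,
      Sum.elim_inl, Sum.elim_inr, dotProduct, mulVec, Finset.mul_sum, ← Finset.sum_add_distrib]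
    exact Finset.sum_congr rfl fun a _ => Finset.sum_congr rfl fun b _ => by ring
  let _ := P3P3P1.structure.top
  have : divisorIntersection M = ⋂ i, {p : P3P3P1 | eval p.coords (F i) ≠ 0}ᶜ := by
    ext p
    simp [mem_divisorIntersection_iff, hFe]
  rw [this]
  exact isClosed_iInter fun i =>
    (isOpen_eval_ne_zero P3P3P1.coords P3P3P1.weight (hF i)).isClosed_compl

theorem residualComponent_subset : residualComponent M ⊆ divisorIntersection M := by
  let _ := P3P3P1.structure.top
  exact (IsClosed.closure_subset_iff isClosed_divisorIntersection).2 Set.sdiff_subset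

/-- A point of `ℙ³ × ℙ³ × ℙ¹` is good if its homogeneous coordinates are. -/
def P3P3P1.IsGood (M : Fin 4 → Mat4) (p : P3P3P1) : Prop :=
  IsGoodPoint M p.1.rep p.2.1.rep (p.2.2.rep 0) (p.2.2.rep 1)

theorem P3P3P1.IsGood.mem_residualComponent {p : P3P3P1} (h : p.IsGood M) :
    p ∈ residualComponent M := by
  let _ := P3P3P1.structure.top
  exact subset_closure ⟨mem_divisorIntersection_iff.2 h.eqn, fun hp => h.ne_zero hp.2⟩

theorem IsGoodPoint.isGood_mk {x y : Fin 4 → ℂ} {q : Fin 2 → ℂ}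
    (h : IsGoodPoint M x y (q 0) (q 1)) (hx : x ≠ 0) (hy : y ≠ 0) (hq : q ≠ 0) :
    (P3P3P1.mk x y q hx hy hq).IsGood M := by
  obtain ⟨a, b, c, ha, hb, hc, h1, h2, h3⟩ := P3P3P1.exists_rep_mk hx hy hq
  rw [P3P3P1.IsGood, h1, h2, h3]
  exact h.smul ha hb hc

theorem tau_eq_mk (p : P3P3P1) : tau p = P3P3P1.mk p.2.1.rep p.1.rep (negSnd p.2.2.rep)
    p.2.1.rep_nonzero p.1.rep_nonzero
    (fun h => p.2.2.rep_nonzero (negSnd_injective (h.trans (map_zero _).symm))) := by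
  conv_lhs => rw [tau, ← p.2.2.mk_rep, Projectivization.map_mk, ← p.1.mk_rep, ← p.2.1.mk_rep]
  rfl

theorem P3P3P1.IsGood.tau {p : P3P3P1} (h : p.IsGood M) : (tau p).IsGood M := by
  rw [tau_eq_mk]
  exact IsGoodPoint.isGood_mk (q := negSnd p.2.2.rep) (IsGoodPoint.swap h) _ _ _

theorem isGood_iff_of_rel {z z' : residualComponent M} (h : (tauSetoid M).r z z') :
    z.1.IsGood M ↔ z'.1.IsGood M := by
  rcases h with h | h
  · rw [h]
  · rw [h]
    exact ⟨fun h => h.tau, fun h => by simpa only [tau_tau] using h.tau⟩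

/-- A point of `Z` with `x ≠ y` defines a point of `X`. -/
def lineOf (z : residualComponent M) (h : z.1.1 ≠ z.1.2.1) : determinantalLocus (spanOf M) :=
  ⟨⟨Submodule.span ℂ {z.1.1.rep, z.1.2.1.rep},
    finrank_span_pair_eq_two (Projectivization.ne_iff_linearIndependent.1 h)⟩,
    (mem_determinantalLocus_iff rfl).2 (det_formMatrix_eq_zero
      (mem_divisorIntersection_iff.1 (residualComponent_subset z.2)) (by
        by_contra! h0
        refine z.1.2.2.rep_nonzero (funext fun i => ?_)
        fin_cases i
        exacts [h0.1, h0.2]))⟩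

theorem P3P3P1.IsGood.ne {p : P3P3P1} (h : p.IsGood M) : p.1 ≠ p.2.1 :=
  Projectivization.ne_iff_linearIndependent.2 h.indep

/-- Two good points with the same line lie in the same orbit of the involution. -/
theorem rel_of_lineOf_eq {z z' : residualComponent M} (h : z.1.IsGood M) (h' : z'.1.IsGood M)
    (he : lineOf z h.ne = lineOf z' h'.ne) : (tauSetoid M).r z z' := by
  have hspan : Submodule.span ℂ {z'.1.1.rep, z'.1.2.1.rep} =
      Submodule.span ℂ {z.1.1.rep, z.1.2.1.rep} := congrArg (fun L => L.1.1) he.symm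
  obtain ⟨a, b, c, ha, hb, hc, ⟨h1, h2, h3, h4⟩ | ⟨h1, h2, h3, h4⟩⟩ := IsGoodPoint.unique h h' hspan
  · refine Or.inl (Prod.ext (Projectivization.eq_of_rep_eq_smul h1)
      (Prod.ext (Projectivization.eq_of_rep_eq_smul h2)
        (Projectivization.eq_of_rep_eq_smul (a := c) (funext fun i => ?_))))
    fin_cases i
    exacts [h3, h4]
  · refine Or.inr (Prod.ext (Projectivization.eq_of_rep_eq_smul h1)
      (Prod.ext (Projectivization.eq_of_rep_eq_smul h2) ?_))
    have e : z'.1.2.2.rep = c • negSnd z.1.2.2.rep := by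
      funext i
      fin_cases i
      exacts [h3, h4]
    rw [tau_eq_mk, P3P3P1.mk, ← z'.1.2.2.mk_rep, Projectivization.mk_eq_mk_iff']
    exact ⟨c, e.symm⟩

/-- Passage from vectors to the chosen representatives of a projective point. The factor `r` is the
same for all forms of degree `d`, so quotients of such forms are unchanged. -/
theorem exists_isGood_of_isGoodPoint {x y : Fin 4 → ℂ} {q : Fin 2 → ℂ}
    (h : IsGoodPoint M x y (q 0) (q 1)) (d : ℕ × ℕ × ℕ) :
    ∃ (z : residualComponent M) (hz : z.1.IsGood M) (r : ℂ), r ≠ 0 ∧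
      (lineOf z hz.ne).1.1 = Submodule.span ℂ {x, y} ∧
      ∀ F : MvPolynomial _ ℂ, F.IsWeightedHomogeneous P3P3P1.weight d →
        eval (P3P3P1.coords z) F = r * eval (Sum.elim x (Sum.elim y q)) F := by
  have hx : x ≠ 0 := h.indep.ne_zero 0
  have hy : y ≠ 0 := h.indep.ne_zero 1
  have hq : q ≠ 0 := fun h0 => h.ne_zero (by rw [h0]; rfl)
  have hg := h.isGood_mk hx hy hq
  obtain ⟨r, hr, he⟩ := P3P3P1.eval_coords_mk hx hy hq d
  refine ⟨⟨_, hg.mem_residualComponent⟩, hg, r, hr, ?_, he⟩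
  change Submodule.span ℂ {_, _} = _
  obtain ⟨a, b, c, ha, hb, hc, h1, h2, h3⟩ := P3P3P1.exists_rep_mk hx hy hq
  rw [h1, h2]
  refine span_pair_eq_of_linearIndependent h.indep ?_
    (Submodule.smul_mem _ _ (Submodule.subset_span (by simp)))
    (Submodule.smul_mem _ _ (Submodule.subset_span (by simp)))
  have := hg.indep
  rwa [h1, h2] at this

/-- The minors of the coordinates `x, y`, as polynomials. -/
noncomputable def minorPoly (k : Fin 4 × Fin 4) : MvPolynomial (Fin 4 ⊕ Fin 4 ⊕ Fin 2) ℂ :=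
  X (Sum.inl k.1) * X (Sum.inr (Sum.inl k.2)) - X (Sum.inl k.2) * X (Sum.inr (Sum.inl k.1))

theorem isWeightedHomogeneous_minorPoly (k : Fin 4 × Fin 4) :
    (minorPoly k).IsWeightedHomogeneous P3P3P1.weight (1, 1, 0) := by
  have hx : ∀ a, (X (Sum.inl a) : MvPolynomial _ ℂ).IsWeightedHomogeneous P3P3P1.weight
    (1, 0, 0) := fun a => isWeightedHomogeneous_X _ _ _
  have hy : ∀ a, (X (Sum.inr (Sum.inl a)) : MvPolynomial _ ℂ).IsWeightedHomogeneous P3P3P1.weight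
    (0, 1, 0) := fun a => isWeightedHomogeneous_X _ _ _
  exact ((hx _).mul (hy _)).sub ((hx _).mul (hy _))

theorem isWeightedHomogeneous_aeval_minorPoly {H : MvPolynomial (Fin 4 × Fin 4) ℂ} {d : ℕ}
    (hH : H.IsWeightedHomogeneous (fun _ => (1 : ℕ)) d) :
    (aeval minorPoly H).IsWeightedHomogeneous P3P3P1.weight (d, d, 0) := by
  let ψ : ℕ →+ ℕ × ℕ × ℕ :=
    { toFun := fun n => (n, n, 0)
      map_zero' := rfl
      map_add' := fun _ _ => rfl }
  exact isWeightedHomogeneous_aeval ψ (fun k => isWeightedHomogeneous_minorPoly k) hH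

theorem eval_aeval_minorPoly (H : MvPolynomial (Fin 4 × Fin 4) ℂ) (p : P3P3P1) :
    eval p.coords (aeval minorPoly H) = eval (minors p.1.rep p.2.1.rep) H := by
  rw [eval_aeval]
  congr 2
  funext k
  simp [minorPoly, minors, P3P3P1.coords]

/-- Plücker coordinates of the line through `x` and `y`. -/
theorem exists_eval_pluecker_lineOf (z : residualComponent M) (h : z.1.1 ≠ z.1.2.1) (d : ℕ) :
    ∃ r : ℂ, r ≠ 0 ∧ ∀ H : MvPolynomial _ ℂ, H.IsWeightedHomogeneous (fun _ => (1 : ℕ)) d →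
      eval (Gr24.pluecker (lineOf z h)) H = r * eval (P3P3P1.coords z) (aeval minorPoly H) := by
  obtain ⟨c, hc, e⟩ := exists_pluecker_eq_smul (L := (lineOf z h).1) (x := z.1.1.rep)
    (y := z.1.2.1.rep) rfl
  refine ⟨c ^ d, pow_ne_zero _ hc, fun H hH => ?_⟩
  rw [e, eval_smul_of_degree hH, eval_aeval_minorPoly]

/-- The map to `X` is continuous where it is defined. -/
theorem isOpen_lineOf_preimage {V : Set (determinantalLocus (spanOf M))}
    (hV : IsOpen[(determinantalStructure (spanOf M)).top] V) :
    IsOpen[(residualStructure M).top] {z | ∃ h, lineOf z h ∈ V} := by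
  refine (isOpen_homogeneousStructure_iff _ _).2 ?_
  rintro z ⟨h, hz⟩
  obtain ⟨d, H, hH, hH0, hHV⟩ := (isOpen_homogeneousStructure_iff _ _).1 hV _ hz
  obtain ⟨i, j, hij⟩ := exists_minors_ne_zero (Projectivization.ne_iff_linearIndependent.1 h)
  have hm : ∀ p : P3P3P1, eval p.coords (minorPoly (i, j)) = minors p.1.rep p.2.1.rep (i, j) :=
    fun p => by simp [minorPoly, minors, P3P3P1.coords]
  -- The additional minor guarantees that `x ≠ y` at the neighbouring points, so that they still
  -- define a subspace.
  refine ⟨_, minorPoly (i, j) * aeval minorPoly H,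
    (isWeightedHomogeneous_minorPoly _).mul (isWeightedHomogeneous_aeval_minorPoly hH), ?_,
    fun z' hz' => ?_⟩
  · rw [map_mul, hm]
    obtain ⟨r, hr, e⟩ := exists_eval_pluecker_lineOf z h d
    rw [e H hH] at hH0
    exact mul_ne_zero hij (right_ne_zero_of_mul hH0)
  · rw [map_mul, hm] at hz'
    have h' : z'.1.1 ≠ z'.1.2.1 := Projectivization.ne_iff_linearIndependent.2
      (linearIndependent_of_minor_ne_zero (left_ne_zero_of_mul hz'))
    obtain ⟨r, hr, e⟩ := exists_eval_pluecker_lineOf z' h' d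
    refine ⟨h', hHV _ ?_⟩
    rw [e H hH]
    exact mul_ne_zero hr (right_ne_zero_of_mul hz')

/-- The subspaces spanned by good points. -/
def goodLocus (M : Fin 4 → Mat4) : Set (determinantalLocus (spanOf M)) :=
  {L | ∃ x y s t, IsGoodPoint M x y s t ∧ L.1.1 = Submodule.span ℂ {x, y}}

theorem isOpen_goodLocus : IsOpen[(determinantalStructure (spanOf M)).top] (goodLocus M) := by
  let _ := (determinantalStructure (spanOf M)).top
  refine isOpen_iff_forall_mem_open.2 ?_
  rintro L ⟨x, y, s, t, h, hL⟩
  obtain ⟨i, j, m, n, O, hO, hLO, hgood, -⟩ := exists_eval_scaledCoords h hL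
  exact ⟨O, fun L' hL' => (hgood L' hL').1, hO, hLO⟩

theorem lineOf_mem_goodLocus {z : residualComponent M} (h : z.1.IsGood M) :
    lineOf z h.ne ∈ goodLocus M :=
  ⟨_, _, _, _, h, rfl⟩

theorem exists_isGood_of_mem_goodLocus {L : determinantalLocus (spanOf M)} (hL : L ∈ goodLocus M) :
    ∃ (z : residualComponent M) (hz : z.1.IsGood M), lineOf z hz.ne = L := by
  obtain ⟨x, y, s, t, h, hL⟩ := hL
  obtain ⟨z, hz, r, -, hzL, -⟩ := exists_isGood_of_isGoodPoint (q := ![s, t]) h 0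
  exact ⟨z, hz, Subtype.ext (Subtype.ext (hzL.trans hL.symm))⟩

/-- The rank condition depends only on the span, and the equations hold throughout `Z`. This
expresses goodness by a preimage of an open set of `X` and one coordinate inequality, hence as an
open condition. -/
theorem isGood_iff {z : residualComponent M} :
    z.1.IsGood M ↔ (∃ h, lineOf z h ∈ goodLocus M) ∧ z.1.2.2.rep 0 ≠ 0 := by
  refine ⟨fun h => ⟨⟨h.ne, lineOf_mem_goodLocus h⟩, h.ne_zero⟩, ?_⟩
  rintro ⟨⟨h, x, y, s, t, hg, hL⟩, h0⟩
  have hL' : Submodule.span ℂ {z.1.1.rep, z.1.2.1.rep} = Submodule.span ℂ {x, y} := hL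
  refine ⟨mem_divisorIntersection_iff.1 (residualComponent_subset z.2),
    Projectivization.ne_iff_linearIndependent.1 h, h0,
    adjugate_formMatrix_ne_zero_of_mem_span ?_ ?_ hg.adj⟩ <;> rw [hL'] <;>
  exact Submodule.subset_span (by simp)

theorem isOpen_isGood : IsOpen[(residualStructure M).top] {z | z.1.IsGood M} := by
  let _ := (residualStructure M).top
  have h0 := isOpen_eval_ne_zero (fun p : residualComponent M => P3P3P1.coords p) P3P3P1.weight
    (isWeightedHomogeneous_X ℂ P3P3P1.weight (Sum.inr (Sum.inr 0)))
  have : {z : residualComponent M | z.1.IsGood M} = {z | ∃ h, lineOf z h ∈ goodLocus M} ∩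
      {p | eval (P3P3P1.coords p) (X (Sum.inr (Sum.inr 0))) ≠ 0} := by
    ext z
    rw [Set.mem_inter_iff, Set.mem_ofPred_eq, Set.mem_ofPred_eq, Set.mem_ofPred_eq, isGood_iff,
      eval_X]
    rfl
  rw [this]
  exact IsOpen.inter (isOpen_lineOf_preimage isOpen_goodLocus) h0

end Points

/-! ### The map from `Z / τ` to `X`: bijection, regularity and density -/

section Birational

open Matrix MvPolynomial

variable {M : Fin 4 → Mat4}

theorem lineOf_eq_of_rel {z z' : residualComponent M} (hr : (tauSetoid M).r z z')
    (h : z.1.1 ≠ z.1.2.1) (h' : z'.1.1 ≠ z'.1.2.1) : lineOf z h = lineOf z' h' := by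
  refine Subtype.ext (Subtype.ext ?_)
  change Submodule.span ℂ {_, _} = Submodule.span ℂ {_, _}
  rcases hr with hr | hr
  · rw [hr]
  · rw [hr]
    exact congrArg _ (Set.pair_comm _ _)

theorem ne_of_rel {z z' : residualComponent M} (hr : (tauSetoid M).r z z')
    (h : z.1.1 ≠ z.1.2.1) : z'.1.1 ≠ z'.1.2.1 := by
  rcases hr with hr | hr
  · rwa [hr]
  · rw [hr]
    exact h.symm

/-- The classes in `Z / τ` of good points. -/
def goodClasses (M : Fin 4 → Mat4) : Set (Quotient (tauSetoid M)) :=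
  Quotient.mk (tauSetoid M) '' {z | z.1.IsGood M}

theorem mk_mem_goodClasses {z : residualComponent M} :
    Quotient.mk (tauSetoid M) z ∈ goodClasses M ↔ z.1.IsGood M := by
  refine ⟨?_, fun h => ⟨z, h, rfl⟩⟩
  rintro ⟨z', h, e⟩
  exact (isGood_iff_of_rel (Quotient.exact e)).1 h

/-- The bijection between classes of good points and the lines spanned by good points. -/
theorem exists_partialEquiv
    (hne : Nonempty (residualComponent M) ↔ Nonempty (determinantalLocus (spanOf M))) :
    ∃ φ : PartialEquiv (Quotient (tauSetoid M)) (determinantalLocus (spanOf M)),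
      φ.source = goodClasses M ∧ φ.target = goodLocus M ∧
        ∀ z (hz : z.1.IsGood M), φ (Quotient.mk (tauSetoid M) z) = lineOf z hz.ne := by
  classical
  -- The two maps of a `PartialEquiv` are total, so each needs values outside its domain; this is
  -- possible only if both varieties are empty or both are nonempty.
  cases isEmpty_or_nonempty (residualComponent M) with
  | inl h =>
    have hX : IsEmpty (determinantalLocus (spanOf M)) :=
      not_nonempty_iff.1 fun h' => not_nonempty_iff.2 h (hne.2 h')
    refine ⟨⟨fun c => isEmptyElim (Quotient.out c), isEmptyElim, goodClasses M, goodLocus M,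
      fun c => isEmptyElim (Quotient.out c), isEmptyElim, fun c => isEmptyElim (Quotient.out c),
      isEmptyElim⟩, rfl, rfl, isEmptyElim⟩
  | inr h =>
    have := hne.1 h
    have : Nonempty (Quotient (tauSetoid M)) := h.map (Quotient.mk _)
    let f : Quotient (tauSetoid M) → determinantalLocus (spanOf M) :=
      -- The arbitrary value is taken only where `x = y`, hence never on a good class.
      Quotient.lift (fun z => if h : z.1.1 ≠ z.1.2.1 then lineOf z h else Classical.arbitrary _) (by
        intro z z' hr
        by_cases h : z.1.1 ≠ z.1.2.1
        · simp only [dif_pos h, dif_pos (ne_of_rel hr h)]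
          exact lineOf_eq_of_rel hr _ _
        · have h' : ¬ z'.1.1 ≠ z'.1.2.1 := fun h' =>
            h (ne_of_rel ((tauSetoid M).iseqv.symm hr) h')
          simp only [dif_neg h, dif_neg h'])
    have hf : ∀ z (hz : z.1.IsGood M), f (Quotient.mk (tauSetoid M) z) = lineOf z hz.ne :=
      fun z hz => dif_pos hz.ne
    have hbij : Set.BijOn f (goodClasses M) (goodLocus M) := by
      refine ⟨?_, ?_, ?_⟩
      · rintro _ ⟨z, hz, rfl⟩
        rw [hf z hz]
        exact lineOf_mem_goodLocus hz
      · rintro _ ⟨z, hz, rfl⟩ _ ⟨z', hz', rfl⟩ e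
        rw [hf z hz, hf z' hz'] at e
        exact Quotient.sound (rel_of_lineOf_eq hz hz' e)
      · intro L hL
        obtain ⟨z, hz, rfl⟩ := exists_isGood_of_mem_goodLocus hL
        exact ⟨_, ⟨z, hz, rfl⟩, hf z hz⟩
    exact ⟨hbij.toPartialEquiv f _ _, rfl, rfl, hf⟩

variable {φ : PartialEquiv (Quotient (tauSetoid M)) (determinantalLocus (spanOf M))}

theorem isMorphismOn_of_lineOf (hs : φ.source = goodClasses M)
    (hφ : ∀ z (hz : z.1.IsGood M), φ (Quotient.mk (tauSetoid M) z) = lineOf z hz.ne) :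
    IsMorphismOn (quotientStructure M) (determinantalStructure (spanOf M)) φ.source φ.target φ := by
  refine ⟨φ.mapsTo, fun V hVt hV => ?_, fun V hVt hV g hg => ?_⟩
  · let _ := (residualStructure M).top
    change IsOpen[(residualStructure M).top.coinduced _] _
    rw [isOpen_coinduced]
    have : Quotient.mk (tauSetoid M) ⁻¹' (φ.source ∩ φ ⁻¹' V) =
        {z | z.1.IsGood M} ∩ {z | ∃ h, lineOf z h ∈ V} := by
      ext z
      rw [Set.mem_preimage, Set.mem_inter_iff, hs, mk_mem_goodClasses, Set.mem_preimage]
      refine and_congr_right fun hz => ?_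
      rw [hφ z hz]
      exact ⟨fun h => ⟨_, h⟩, fun ⟨_, h⟩ => h⟩
    rw [this]
    exact isOpen_isGood.inter (isOpen_lineOf_preimage hV)
  · rintro z ⟨hz, hzV⟩
    rw [hs, mk_mem_goodClasses] at hz
    rw [Set.mem_preimage, hφ z hz] at hzV
    obtain ⟨d, F, G, hF, hG, hG0, e⟩ := hg _ hzV
    obtain ⟨r, hr, hz'⟩ := exists_eval_pluecker_lineOf z hz.ne d
    refine ⟨_, _, _, isWeightedHomogeneous_aeval_minorPoly hF,
      isWeightedHomogeneous_aeval_minorPoly hG, ?_, ?_⟩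
    · rw [hz' G hG] at hG0
      exact right_ne_zero_of_mul hG0
    · rintro z₁ ⟨hz₁, hz₁V⟩ h0
      rw [hs, mk_mem_goodClasses] at hz₁
      rw [Set.mem_preimage, hφ z₁ hz₁] at hz₁V
      obtain ⟨r₁, hr₁, hz₁'⟩ := exists_eval_pluecker_lineOf z₁ hz₁.ne d
      change g (φ (Quotient.mk (tauSetoid M) z₁)) = _
      rw [hφ z₁ hz₁, e _ hz₁V (by rw [hz₁' G hG]; exact mul_ne_zero hr₁ h0),
        hz₁' F hF, hz₁' G hG, mul_div_mul_left _ _ hr₁]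

theorem isMorphismOn_symm_of_lineOf (hs : φ.source = goodClasses M) (ht : φ.target = goodLocus M)
    (hφ : ∀ z (hz : z.1.IsGood M), φ (Quotient.mk (tauSetoid M) z) = lineOf z hz.ne) :
    IsMorphismOn (determinantalStructure (spanOf M)) (quotientStructure M) φ.target φ.source
      φ.symm := by
  have hsymm : ∀ z (hz : z.1.IsGood M),
      φ.symm (lineOf z hz.ne) = Quotient.mk (tauSetoid M) z := fun z hz => by
    rw [← hφ z hz]
    exact φ.left_inv (by rw [hs]; exact mk_mem_goodClasses.2 hz)
  have hgood : ∀ L ∈ φ.target, ∃ (z : residualComponent M) (hz : z.1.IsGood M),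
      lineOf z hz.ne = L := fun L hL => exists_isGood_of_mem_goodLocus (by rwa [← ht])
  refine ⟨φ.mapsTo_symm, fun V hVs hV => ?_, fun V hVs hV g hg => ?_⟩
  · let _ := (determinantalStructure (spanOf M)).top
    rw [isOpen_iff_forall_mem_open]
    rintro L ⟨hL, hLV⟩
    obtain ⟨z, hz, rfl⟩ := hgood L hL
    rw [Set.mem_preimage, hsymm z hz] at hLV
    have hV' : IsOpen[(residualStructure M).top] (Quotient.mk (tauSetoid M) ⁻¹' V) := hV
    obtain ⟨d, F, hF, hF0, hFV⟩ := (isOpen_homogeneousStructure_iff _ _).1 hV' z hLV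
    obtain ⟨O, hO, hzO, h⟩ := exists_isOpen_forall_exists_eval_ne_zero hz rfl hF
      (L₀ := lineOf z hz.ne) (by rw [vec_two_eta]; exact hF0)
    refine ⟨O, fun L hL => ?_, hO, hzO⟩
    obtain ⟨x, y, s, t, hg, hLs, hg0⟩ := h L hL
    obtain ⟨z', hz', r, hr, hzL, he⟩ := exists_isGood_of_isGoodPoint (q := ![s, t]) hg d
    obtain rfl : lineOf z' hz'.ne = L := Subtype.ext (Subtype.ext (hzL.trans hLs.symm))
    refine ⟨by rw [ht]; exact lineOf_mem_goodLocus hz', ?_⟩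
    rw [Set.mem_preimage, hsymm z' hz']
    exact hFV z' (by rw [he F hF]; exact mul_ne_zero hr hg0)
  · refine isRegularOn_of_eqOn_regularAt ?_
    rintro L ⟨hL, hLV⟩
    obtain ⟨z, hz, rfl⟩ := hgood L hL
    rw [Set.mem_preimage, hsymm z hz] at hLV
    obtain ⟨d, F, G, hF, hG, hG0, e⟩ := hg z hLV
    -- The quotient formula for `g` says nothing where `G` vanishes. With `F * G` and `G * G` in
    -- place of `F` and `G`, the required identity holds there trivially.
    refine exists_mem_regularAt_eqOn hz rfl (hF.mul hG) (hG.mul hG) ?_ _ _ ?_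
    · rw [vec_two_eta, map_mul]
      exact mul_ne_zero hG0 hG0
    · rintro L ⟨hL, hLV⟩ x y s t hg hLs
      obtain ⟨z', hz', r, hr, hzL, he⟩ := exists_isGood_of_isGoodPoint (q := ![s, t]) hg d
      obtain rfl : lineOf z' hz'.ne = L := Subtype.ext (Subtype.ext (hzL.trans hLs.symm))
      rw [Set.mem_preimage, hsymm z' hz'] at hLV
      rw [Function.comp_apply, hsymm z' hz', map_mul, map_mul]
      by_cases h0 : eval (Sum.elim x (Sum.elim y ![s, t])) G = 0
      · rw [h0]
        ring
      · have e' : g (Quotient.mk (tauSetoid M) z') = _ :=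
          e z' hLV (by rw [he G hG]; exact mul_ne_zero hr h0)
        rw [e', he F hF, he G hG, mul_div_mul_left _ _ hr]
        field_simp

/-- Points of the divisor intersection off the diagonal component define a nonzero tensor in the
common kernel of the bilinear forms. -/
theorem exists_symmetric_tensor_ne_zero {p : P3P3P1} (hp : p ∉ diagonalComponent) :
    ∃ a b, (p.2.2.rep 0 + p.2.2.rep 1) * (p.1.rep a * p.2.1.rep b) +
      (p.2.2.rep 0 - p.2.2.rep 1) * (p.2.1.rep a * p.1.rep b) ≠ 0 := by
  by_cases h : p.1 = p.2.1
  · have h0 : p.2.2.rep 0 ≠ 0 := fun h0 => hp ⟨h, h0⟩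
    obtain ⟨a, ha⟩ := Function.ne_iff.1 p.2.1.rep_nonzero
    refine ⟨a, a, ?_⟩
    rw [h]
    intro h1
    have : 2 * p.2.2.rep 0 * (p.2.1.rep a * p.2.1.rep a) = 0 := by linear_combination h1
    exact mul_ne_zero (mul_ne_zero two_ne_zero h0) (mul_ne_zero ha ha) this
  · have hv : (![0, p.2.2.rep 0 + p.2.2.rep 1, p.2.2.rep 0 - p.2.2.rep 1, 0] : Fin 4 → ℂ) ≠ 0 := by
      intro h0
      have h1 := congrFun h0 1
      have h2 := congrFun h0 2
      simp only [cons_val, Pi.zero_apply] at h1 h2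
      refine p.2.2.rep_nonzero (funext fun i => ?_)
      fin_cases i
      · change p.2.2.rep 0 = 0
        linear_combination (h1 + h2) / 2
      · change p.2.2.rep 1 = 0
        linear_combination (h1 - h2) / 2
    obtain ⟨a, b, hab⟩ :=
      exists_tensor_ne_zero (Projectivization.ne_iff_linearIndependent.1 h) hv
    refine ⟨a, b, ?_⟩
    simpa only [cons_val, zero_mul, zero_add, add_zero] using hab

/-- For generic matrices the good points are dense in `Z`. -/
theorem exists_generic_dense_isGood :
    ∃ P : MvPolynomial (Fin 4 × Fin 4 × Fin 4) ℂ, P ≠ 0 ∧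
      ∀ M : Fin 4 → Mat4, eval (entries M) P ≠ 0 →
        @Dense _ (residualStructure M).top {z | z.1.IsGood M} := by
  obtain ⟨P, hP, h⟩ := exists_generic_dense_isGoodPoint
  refine ⟨P, hP, fun M hM => ?_⟩
  let _ := (residualStructure M).top
  refine dense_iff_inter_open.2 ?_
  rintro U hU ⟨z, hz⟩
  obtain ⟨d, F, hF, hF0, hFU⟩ := (isOpen_homogeneousStructure_iff _ _).1 hU z hz
  let _ := P3P3P1.structure.top
  -- `Z` is a closure, so a neighbourhood of `z` contains a solution off the diagonal component.
  -- There the tensor is nonzero, as the incidence argument demands.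
  obtain ⟨p, hp0, hp, hpΔ⟩ := mem_closure_iff.1 z.2 _
    (isOpen_eval_ne_zero P3P3P1.coords P3P3P1.weight hF) hF0
  obtain ⟨x, y, q, hg, hq⟩ := h M hM p.1.rep p.2.1.rep p.2.2.rep
    (mem_divisorIntersection_iff.1 hp) (exists_symmetric_tensor_ne_zero hpΔ) F hp0
  obtain ⟨z', hz', r, hr, -, he⟩ := exists_isGood_of_isGoodPoint hg d
  exact ⟨z', hFU z' (by rw [he F hF]; exact mul_ne_zero hr hq), hz'⟩

/-- For generic matrices the lines spanned by good points are dense in `X`. -/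
theorem exists_generic_dense_goodLocus :
    ∃ P : MvPolynomial (Fin 4 × Fin 4 × Fin 4) ℂ, P ≠ 0 ∧
      ∀ M : Fin 4 → Mat4, eval (entries M) P ≠ 0 →
        @Dense _ (determinantalStructure (spanOf M)).top (goodLocus M) := by
  obtain ⟨P, hP, h⟩ := exists_generic_dense_determinantalLocus
  refine ⟨P, hP, fun M hM => ?_⟩
  let _ := (determinantalStructure (spanOf M)).top
  refine dense_iff_inter_open.2 ?_
  rintro U hU ⟨L, hL⟩
  obtain ⟨d, H, hH, hH0, hHU⟩ := (isOpen_homogeneousStructure_iff _ _).1 hU L hL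
  let mp : Fin 4 × Fin 4 → MvPolynomial (Fin 4 ⊕ Fin 4) ℂ := fun k =>
    X (Sum.inl k.1) * X (Sum.inr k.2) - X (Sum.inl k.2) * X (Sum.inr k.1)
  have hmp : ∀ u w : Fin 4 → ℂ, eval (Sum.elim u w) (aeval mp H) = eval (minors u w) H := by
    intro u w
    rw [eval_aeval]
    congr 2
    funext k
    simp [mp, minors]
  let b := Module.finBasisOfFinrankEq ℂ L.1.1 L.1.2
  have hbi : LinearIndependent ℂ ![(b 0 : Fin 4 → ℂ), (b 1 : Fin 4 → ℂ)] := by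
    have := b.linearIndependent.map' L.1.1.subtype L.1.1.ker_subtype
    rwa [show L.1.1.subtype ∘ b = ![(b 0 : Fin 4 → ℂ), (b 1 : Fin 4 → ℂ)] from
      funext fun i => by fin_cases i <;> rfl] at this
  have hbs : L.1.1 = Submodule.span ℂ {(b 0 : Fin 4 → ℂ), (b 1 : Fin 4 → ℂ)} := by
    refine (Submodule.eq_of_le_of_finrank_eq (Submodule.span_le.2 ?_) ?_).symm
    · rintro v (rfl | rfl) <;> exact Subtype.prop _
    · rw [finrank_span_pair_eq_two hbi, L.1.2]
  have hLe : ∀ (L' : determinantalLocus (spanOf M)) (u w : Fin 4 → ℂ),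
      L'.1.1 = Submodule.span ℂ {u, w} →
      (eval (Gr24.pluecker L') H ≠ 0 ↔ eval (Sum.elim u w) (aeval mp H) ≠ 0) := by
    intro L' u w hL'
    obtain ⟨c, hc, e⟩ := exists_pluecker_eq_smul hL'
    rw [hmp, e, eval_smul_of_degree hH]
    exact (mul_ne_zero_iff.trans (and_iff_right (pow_ne_zero _ hc)))
  obtain ⟨u, w, hi, ⟨x, y, s, t, hg, hsp⟩, h0⟩ := h M hM _ _ hbi
    ((mem_determinantalLocus_iff hbs).1 L.2) _ ((hLe L _ _ hbs).1 hH0)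
  obtain ⟨z, hz, r, -, hzL, -⟩ := exists_isGood_of_isGoodPoint (q := ![s, t]) hg 0
  exact ⟨lineOf z hz.ne, hHU _ ((hLe _ u w (hzL.trans hsp)).2 h0), lineOf_mem_goodLocus hz⟩

/-- The quotient map is continuous and surjective, so it sends dense sets to dense sets. -/
theorem dense_goodClasses (h : @Dense _ (residualStructure M).top {z | z.1.IsGood M}) :
    @Dense _ (quotientStructure M).top (goodClasses M) := by
  let _ := (residualStructure M).top
  let _ := (quotientStructure M).top
  have hc : Continuous (Quotient.mk (tauSetoid M)) := continuous_coinduced_rng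
  exact Quotient.mk_surjective.denseRange.dense_image hc h

end Birational

theorem mainTheorem6 :
    ∃ P : MvPolynomial (Fin 4 × Fin 4 × Fin 4) ℂ, P ≠ 0 ∧
      ∀ M : Fin 4 → Mat4, LinearIndependent ℂ M →
        MvPolynomial.eval (fun k => M k.1 k.2.1 k.2.2) P ≠ 0 →
        (∀ z ∈ residualComponent M, z.1 ≠ z.2.1 →
          ∃ L ∈ determinantalLocus (spanOf M), L.1 = z.1.submodule ⊔ z.2.1.submodule) ∧
        ∃ φ : PartialEquiv (Quotient (tauSetoid M)) (determinantalLocus (spanOf M)),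
          IsBirationalEquiv (quotientStructure M) (determinantalStructure (spanOf M)) φ ∧
          ∀ z : residualComponent M, Quotient.mk (tauSetoid M) z ∈ φ.source →
            (φ (Quotient.mk (tauSetoid M) z)).1.1 = z.1.1.submodule ⊔ z.1.2.1.submodule := by
  obtain ⟨P₁, hP₁, hd₁⟩ := exists_generic_dense_isGood
  obtain ⟨P₂, hP₂, hd₂⟩ := exists_generic_dense_goodLocus
  refine ⟨P₁ * P₂, mul_ne_zero hP₁ hP₂, fun M _ hM => ⟨fun z hz hne => ?_, ?_⟩⟩
  · refine ⟨(lineOf ⟨z, hz⟩ hne).1, (lineOf ⟨z, hz⟩ hne).2, ?_⟩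
    rw [Projectivization.submodule_sup_submodule]
    rfl
  rw [map_mul] at hM
  specialize hd₁ M (left_ne_zero_of_mul hM)
  specialize hd₂ M (right_ne_zero_of_mul hM)
  -- A dense subset of a nonempty space is nonempty, and good points exist on one side exactly when
  -- they exist on the other.
  have hne : Nonempty (residualComponent M) ↔ Nonempty (determinantalLocus (spanOf M)) := by
    constructor
    · intro hZ
      let _ := (residualStructure M).top
      obtain ⟨z, hz⟩ := hd₁.nonempty
      exact ⟨lineOf z (P3P3P1.IsGood.ne hz)⟩
    · intro hX
      let _ := (determinantalStructure (spanOf M)).top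
      obtain ⟨L, hL⟩ := hd₂.nonempty
      obtain ⟨z, -⟩ := exists_isGood_of_mem_goodLocus hL
      exact ⟨z⟩
  obtain ⟨φ, hs, ht, hφ⟩ := exists_partialEquiv hne
  have hpre : Quotient.mk (tauSetoid M) ⁻¹' goodClasses M = {z | z.1.IsGood M} :=
    Set.ext fun z => mk_mem_goodClasses
  refine ⟨φ, ⟨?_, ?_, ?_, ?_, isMorphismOn_of_lineOf hs hφ,
    isMorphismOn_symm_of_lineOf hs ht hφ⟩,
    fun z hz => ?_⟩
  · rw [hs]
    change IsOpen[(residualStructure M).top.coinduced _] _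
    rw [isOpen_coinduced, hpre]
    exact isOpen_isGood
  · rw [hs]
    exact dense_goodClasses hd₁
  · rw [ht]
    exact isOpen_goodLocus
  · rwa [ht]
  · rw [hs, mk_mem_goodClasses] at hz
    rw [hφ z hz, Projectivization.submodule_sup_submodule]
    rfl
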